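/- **Theorem (Lower bound on coAP in an infinite language).** There are a language $L$ with infinitely many relation symbols (all of positive arity) that has a computable representation, a computable $L$-structure $\mathcal M$, and a computable age $\mathbf K$ which is a canonical computable age of $\mathcal M$, such that $\mathbf K$ has the cofinal amalgamation property (coAP), and for every Turing degree $\mathbf s$: if $\mathbf K$ has an $\mathbf s$-computable witness to coAP, then $\mathbf 0'' \le_{\mathrm T} \mathbf s$. Here the following terminology is used. * A *computable representation* of $L$ numbers the relation symbols and the function symbols of $L$ bijectively by two disjoint computable subsets of $\omega$ such that the arity function is computable. A structure with underlying set $M\subseteq\omega$ is *computable* if $M$ is computable and the sets of true instances of relation symbols, of false instances of relation symbols, and of true equations $f(\bar a)=b$ ($f$ a function symbol, $\bar a, b$ in $M$) are c.e. * A *computable age* $\mathbf K$ is a sequence $(\bar a_i,\mathcal A_i)_{i\in\omega}$, computable uniformly in $i$, where $\mathcal A_i$ is a computable $L$-structure with underlying set contained in $\omega$ and generated by the finite tuple $\bar a_i$. It represents the class of all structures isomorphic to some $\mathcal A_i$. It is a *canonical computable age* of $\mathcal M$ if $(\bar a_i)_{i\in\omega}$ is a computable enumeration of all finite tuples of $\mathcal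 M$, each occurring infinitely often, and $\mathcal A_i$ is the substructure of $\mathcal M$ generated by $\bar a_i$. * A member $\mathcal A$ of a class of structures is an *amalgamation base* if any two embeddings $f_B\colon \mathcal A\to \mathcal B$, $f_C\colon \mathcal A\to \mathcal C$ into members of the class can be completed by embeddings $g_B\colon \mathcal B\to \mathcal D$, $g_C\colon \mathcal C\to \mathcal D$ into a member of the class with $g_B f_B=g_C f_C$. The class has *coAP* if each of its members embeds into an amalgamation base of the class; $\mathbf K$ has coAP if the class it represents does. * A *potential embedding* is a triple $F=(i,j,\bar c)$ with $\bar c$ a finite tuple in $\mathcal A_j$; we put $\operatorname{dom} F=i$, $\operatorname{codom} F=j$, $\operatorname{range} F=\bar c$. It is an *embedding* (*isomorphism*) if some embedding (isomorphism) $\mathcal A_i\to\mathcal A_j$ carries $\bar a_i$ to $\bar c$; this map is then unique. If $\operatorname{codom}F=\operatorname{dom}G$, then $G\circ F$ has the domain of $F$ and the codomain of $G$; its range is the image of $\operatorname{range}F$ under the map given by $G$ if $G$ is an embedding, and $\operatorname{range}G$ otherwise. * A *potential span* is a pair $(F_0,F_1)$ of potential embeddings with $\operatorname{dom}F_0=\operatorname{dom}F_1$;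 it is a *span* if both are embeddings. An *amalgamation diagram* over $(F_0,F_1)$ is a pair $(G_0,G_1)$ where $G_0$ is an embedding, $G_1$ is a potential embedding, $\operatorname{dom}G_k=\operatorname{codom}F_k$ for $k=0,1$, $\operatorname{codom}G_0=\operatorname{codom}G_1$, and, if $(F_0,F_1)$ is a span, $G_1$ is an embedding and $G_0\circ F_0=G_1\circ F_1$. * A *witness to coAP* for $\mathbf K$ is a pair $(W,\varphi)$ where $W$ is a set of embeddings that is closed under composition with isomorphisms on either side, contains for each $i$ some $F$ with $\operatorname{dom}F=i$, and is such that $\mathcal A_{\operatorname{codom}F}$ is an amalgamation base of the class represented by $\mathbf K$ for every $F\in W$; and $\varphi$ is a partial function that maps each $(F,G_0,G_1)$, with $F\in W$ and $(G_0,G_1)$ a potential span with $\operatorname{dom}G_0=\operatorname{dom}G_1=\operatorname{codom}F$, to an amalgamation diagram over $(G_0,G_1)$. The witness is *$\mathbf s$-computable* if $W$ is $\mathbf s$-c.e. and $\varphi$ is an $\mathbf s$-computable partial function. * $\mathbf 0''$ is the double Turing jump of the least Turing degree $\mathbf 0$. -/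

import Mathlib

open scoped FirstOrder

/-! ### Oracle machines, relative computability and the Turing jump

Relative computability is Mathlib's `RecursiveIn`.  The Turing degree of a set `S` of natural
numbers is represented by `S` itself, used as an oracle through its characteristic function. -/

namespace Oracle

/-- The characteristic function of `S`, as an oracle. -/
noncomputable def chi (S : Set ℕ) : ℕ →. ℕ := fun n => Part.some (S.indicator 1 n)

/-- `A ≤_T B` for sets of natural numbers. -/
def Reducible (A B : Set ℕ) : Prop := TuringReducible (chi A) (chi B)

/-- `f` is an `S`-computable partial function. -/
def PartialComputable {α σ : Type} [Primcodable α] [Primcodable σ] (S : Set ℕ)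
    (f : α →. σ) : Prop :=
  RecursiveIn {chi S} f

/-- `p` is `S`-computably enumerable: it is the domain of an `S`-computable partial function. -/
def Enumerable {α : Type} [Primcodable α] (S : Set ℕ) (p : α → Prop) : Prop :=
  RecursiveIn {chi S} (fun a => Part.assert (p a) fun _ => Part.some ())

/-- Programs for oracle machines: Mathlib's `Nat.Partrec.Code` with one more instruction, which
queries the oracle. -/
inductive Code : Type
  | zero : Code
  | succ : Code
  | left : Code
  | right : Code
  | oracle : Code
  | pair : Code → Code → Code
  | comp : Code → Code → Code
  | prec : Code → Code → Code
  | rfind' : Code → Code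

namespace Code

/-- The partial function computed by a program with oracle `g`. -/
def eval (g : ℕ →. ℕ) : Code → ℕ →. ℕ
  | zero => pure 0
  | succ => Nat.succ
  | left => ↑fun n : ℕ => n.unpair.1
  | right => ↑fun n : ℕ => n.unpair.2
  | oracle => g
  | pair cf cg => fun n => Nat.pair <$> eval g cf n <*> eval g cg n
  | comp cf cg => fun n => eval g cg n >>= eval g cf
  | prec cf cg =>
    Nat.unpaired fun a n =>
      n.rec (eval g cf a) fun y IH => do
        let i ← IH
        eval g cg (Nat.pair a (Nat.pair y i))
  | rfind' cf =>
    Nat.unpaired fun a m =>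
      (Nat.rfind fun n => (fun m => m = 0) <$> eval g cf (Nat.pair a (n + m))).map (· + m)

/-- The standard enumeration of the programs: `ofNat e` is the `e`-th oracle machine. -/
def ofNat : ℕ → Code
  | 0 => zero
  | 1 => succ
  | 2 => left
  | 3 => right
  | 4 => oracle
  | n + 5 =>
    let m := n.div2.div2
    match n.bodd, n.div2.bodd with
    | false, false => pair (ofNat m.unpair.1) (ofNat m.unpair.2)
    | false, true => comp (ofNat m.unpair.1) (ofNat m.unpair.2)
    | true, false => prec (ofNat m.unpair.1) (ofNat m.unpair.2)
    | true, true => rfind' (ofNat m)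
termination_by n => n
decreasing_by
  all_goals
    have h₁ := Nat.unpair_left_le n.div2.div2
    have h₂ := Nat.unpair_right_le n.div2.div2
    have h₃ : n.div2.div2 ≤ n := by
      simp only [Nat.div2_val]
      omega
    omega

end Code

/-- The Turing jump `S' = {e | {e}^S(e) halts}`. -/
def jump (S : Set ℕ) : Set ℕ := {e | ((Code.ofNat e).eval (chi S) e).Dom}

/-- The double jump `0''` of the least Turing degree. -/
def zeroDoubleJump : Set ℕ := jump (jump ∅)

end Oracle

/-! ### Computable languages and computable structures -/

/-- A computable representation of a language: its relation symbols and its function symbols are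
numbered by disjoint computable sets of natural numbers, and arities are computable. -/
structure CompRep (L : FirstOrder.Language.{0, 0}) where
  relDom : Set ℕ
  funDom : Set ℕ
  rel : relDom ≃ Σ n, L.Relations n
  func : funDom ≃ Σ n, L.Functions n
  relDom_computable : ComputablePred fun n => n ∈ relDom
  funDom_computable : ComputablePred fun n => n ∈ funDom
  disjoint : Disjoint relDom funDom
  arity_computable : ∃ ar : ℕ → ℕ, Computable ar ∧
    (∀ n : relDom, ar n = (rel n).1) ∧ ∀ n : funDom, ar n = (func n).1

namespace CompRep

variable {L : FirstOrder.Language.{0, 0}} (ρ : CompRep L)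

/-- `M ⊨ R(a)`, where `R` is the relation symbol with number `n` and `a` is a tuple in `M`. -/
def Holds (M : Set ℕ) [L.Structure M] (n : ℕ) (a : List ℕ) : Prop :=
  ∃ (hn : n ∈ ρ.relDom) (x : Fin (ρ.rel ⟨n, hn⟩).1 → M),
    a = List.ofFn (fun k => (x k : ℕ)) ∧ FirstOrder.Language.Structure.RelMap (ρ.rel ⟨n, hn⟩).2 x

/-- `M ⊨ ¬ R(a)`, where `R` is the relation symbol with number `n` and `a` is a tuple in `M`. -/
def Fails (M : Set ℕ) [L.Structure M] (n : ℕ) (a : List ℕ) : Prop :=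
  ∃ (hn : n ∈ ρ.relDom) (x : Fin (ρ.rel ⟨n, hn⟩).1 → M),
    a = List.ofFn (fun k => (x k : ℕ)) ∧ ¬ FirstOrder.Language.Structure.RelMap (ρ.rel ⟨n, hn⟩).2 x

/-- `M ⊨ f(a) = b`, where `f` is the function symbol with number `n` and `a`, `b` are in `M`. -/
def Maps (M : Set ℕ) [L.Structure M] (n : ℕ) (a : List ℕ) (b : ℕ) : Prop :=
  ∃ (hn : n ∈ ρ.funDom) (x : Fin (ρ.func ⟨n, hn⟩).1 → M),
    a = List.ofFn (fun k => (x k : ℕ)) ∧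
      ((FirstOrder.Language.Structure.funMap (ρ.func ⟨n, hn⟩).2 x : M) : ℕ) = b

/-- The `L`-structures `X i`, with underlying sets of natural numbers, are computable uniformly
in `i`: the underlying sets are computable, and the relations, their negations and the graphs of
the functions are c.e. -/
def UniformlyComputable {ι : Type} [Primcodable ι] (X : ι → Set ℕ) [∀ i, L.Structure (X i)] :
    Prop :=
  ComputablePred (fun p : ι × ℕ => p.2 ∈ X p.1) ∧
  REPred (fun p : ι × ℕ × List ℕ => ρ.Holds (X p.1) p.2.1 p.2.2) ∧
  REPred (fun p : ι × ℕ × List ℕ => ρ.Fails (X p.1) p.2.1 p.2.2) ∧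
  REPred (fun p : ι × ℕ × List ℕ × ℕ => ρ.Maps (X p.1) p.2.1 p.2.2.1 p.2.2.2)

/-- `M` is a computable structure. -/
def IsComputable (M : Set ℕ) [L.Structure M] : Prop :=
  ρ.UniformlyComputable (fun _ : Unit => M)

end CompRep

/-! ### Ages, amalgamation bases and the cofinal amalgamation property -/

section CoAP

variable {L : FirstOrder.Language.{0, 0}}

/-- `A` is an amalgamation base in the class `𝒦`. -/
def IsAmalgamationBase (𝒦 : Set (CategoryTheory.Bundled.{0} L.Structure))
    (A : CategoryTheory.Bundled.{0} L.Structure) : Prop :=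
  A ∈ 𝒦 ∧ ∀ B C : CategoryTheory.Bundled.{0} L.Structure, B ∈ 𝒦 → C ∈ 𝒦 →
    ∀ (fB : A ↪[L] B) (fC : A ↪[L] C),
    ∃ D : CategoryTheory.Bundled.{0} L.Structure, D ∈ 𝒦 ∧ ∃ (gB : B ↪[L] D) (gC : C ↪[L] D),
      gB.comp fB = gC.comp fC

/-- The cofinal amalgamation property: every member of `𝒦` embeds into an amalgamation base. -/
def HasCoAP (𝒦 : Set (CategoryTheory.Bundled.{0} L.Structure)) : Prop :=
  ∀ A ∈ 𝒦, ∃ A' : CategoryTheory.Bundled.{0} L.Structure, IsAmalgamationBase 𝒦 A' ∧ Nonempty (A ↪[L] A')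

end CoAP

/-- A sequence `(a i, A i)` where `A i` is an `L`-structure whose underlying set is a set of
natural numbers, and `a i` is a finite tuple that generates `A i`. -/
structure AgeRep (L : FirstOrder.Language.{0, 0}) where
  carrier : ℕ → Set ℕ
  str : ∀ i, L.Structure (carrier i)
  tuple : ∀ i, List (carrier i)
  generates : ∀ i, FirstOrder.Language.Substructure.closure L {x | x ∈ tuple i} = ⊤

attribute [instance] AgeRep.str

/-- Codes for potential embeddings: `(i, j, c)` has domain (the `i`-th member of the age)
`i`, codomain `j` and range the tuple `c`. -/
abbrev PotEmb : Type := ℕ × ℕ × List ℕ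

namespace PotEmb

def dom (F : PotEmb) : ℕ := F.1

def cod (F : PotEmb) : ℕ := F.2.1

def rng (F : PotEmb) : List ℕ := F.2.2

end PotEmb

namespace AgeRep

variable {L : FirstOrder.Language.{0, 0}} (K : AgeRep L)

/-- The age represented by `K`: all structures isomorphic to some `A i`. -/
def age : Set (CategoryTheory.Bundled.{0} L.Structure) := {B | ∃ i, Nonempty (B ≃[L] K.carrier i)}

/-- `K` is a computable age. -/
def IsComputable (ρ : CompRep L) : Prop :=
  Computable (fun i => (K.tuple i).map (fun x => (x : ℕ))) ∧ ρ.UniformlyComputable K.carrier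

/-- `K` is a canonical computable age of `M`: for some computable enumeration `a` of all finite
tuples of `M`, each occurring infinitely often, `K` is the sequence of the tuples `a i` with the
substructures of `M` that they generate.  As `A i` is generated by its tuple, the latter says that
the inclusion is an embedding of `A i` into `M` which carries the tuple of `A i` to `a i`. -/
def IsCanonicalAgeOf (M : Set ℕ) [L.Structure M] : Prop :=
  ∃ a : ℕ → List M, Computable (fun i => (a i).map (fun x => (x : ℕ))) ∧
    (∀ t : List M, {i | a i = t}.Infinite) ∧
    ∀ i, ∃ f : K.carrier i ↪[L] M, (∀ x, (f x : ℕ) = x) ∧ (K.tuple i).map f = a i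

/-- `F` is a potential embedding: its range is a tuple in the codomain. -/
def IsPotential (F : PotEmb) : Prop := ∀ x ∈ F.rng, x ∈ K.carrier F.cod

/-- The `L`-embedding `f` carries the distinguished tuple of the domain of `F` to the range
of `F`. -/
def Realizes (F : PotEmb) (f : K.carrier F.dom ↪[L] K.carrier F.cod) : Prop :=
  (K.tuple F.dom).map (fun x => (f x : ℕ)) = F.rng

/-- `F` is an embedding in `K`. -/
def IsEmbedding (F : PotEmb) : Prop := ∃ f, K.Realizes F f

/-- `F` is an isomorphism in `K`. -/
def IsIso (F : PotEmb) : Prop :=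
  ∃ f : K.carrier F.dom ≃[L] K.carrier F.cod, K.Realizes F f.toEmbedding

open Classical in
/-- The composition `G ∘ F` (meaningful when the codomain of `F` is the domain of `G`): if `G` is
an embedding, its range is the image of the range of `F` under the embedding that realizes `G`;
otherwise its range is the range of `G`. -/
noncomputable def comp (G F : PotEmb) : PotEmb :=
  (F.dom, G.cod,
    if h : K.IsEmbedding G then
      F.rng.map fun x => if hx : x ∈ K.carrier G.dom then (h.choose ⟨x, hx⟩ : ℕ) else x
    else G.rng)

/-- `(F₀, F₁)` is a potential span. -/
def IsPotentialSpan (F₀ F₁ : PotEmb) : Prop :=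
  K.IsPotential F₀ ∧ K.IsPotential F₁ ∧ F₀.dom = F₁.dom

/-- `(F₀, F₁)` is a span. -/
def IsSpan (F₀ F₁ : PotEmb) : Prop :=
  K.IsPotentialSpan F₀ F₁ ∧ K.IsEmbedding F₀ ∧ K.IsEmbedding F₁

/-- `(G₀, G₁)` is an amalgamation diagram over the potential span `(F₀, F₁)`. -/
def IsAmalgamationDiagram (F₀ F₁ G₀ G₁ : PotEmb) : Prop :=
  K.IsEmbedding G₀ ∧ K.IsPotential G₁ ∧ G₀.dom = F₀.cod ∧ G₁.dom = F₁.cod ∧ G₀.cod = G₁.cod ∧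
    (K.IsSpan F₀ F₁ → K.IsEmbedding G₁ ∧ K.comp G₀ F₀ = K.comp G₁ F₁)

/-- `W` is a collection of distinguished extensions. -/
structure IsDistinguished (W : Set PotEmb) : Prop where
  isEmbedding : ∀ F ∈ W, K.IsEmbedding F
  comp_iso : ∀ F ∈ W, ∀ G, K.IsIso G → G.cod = F.dom → K.comp F G ∈ W
  iso_comp : ∀ F ∈ W, ∀ H, K.IsIso H → H.dom = F.cod → K.comp H F ∈ W
  exists_dom : ∀ i, ∃ F ∈ W, F.dom = i

/-- `(W, φ)` is a witness to the cofinal amalgamation property.  (The values of `φ` outside of the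
set of inputs `(F, G₀, G₁)` described in `diagram` are irrelevant.) -/
structure IsWitness (W : Set PotEmb) (φ : PotEmb × PotEmb × PotEmb →. PotEmb × PotEmb) :
    Prop where
  distinguished : K.IsDistinguished W
  base : ∀ F ∈ W, IsAmalgamationBase K.age (CategoryTheory.Bundled.of (K.carrier F.cod))
  diagram : ∀ F ∈ W, ∀ G₀ G₁, K.IsPotentialSpan G₀ G₁ → G₀.dom = F.cod →
    ∃ H₀ H₁, (H₀, H₁) ∈ φ (F, G₀, G₁) ∧ K.IsAmalgamationDiagram G₀ G₁ H₀ H₁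

/-- `K` has an `S`-computable witness to the cofinal amalgamation property: `W` is `S`-c.e. and
`φ` is an `S`-computable partial function. -/
def HasCcoAP (S : Set ℕ) : Prop :=
  ∃ (W : Set PotEmb) (φ : PotEmb × PotEmb × PotEmb →. PotEmb × PotEmb),
    K.IsWitness W φ ∧ Oracle.Enumerable S (fun F : PotEmb => F ∈ W) ∧
      Oracle.PartialComputable S φ

end AgeRep

/-! Being `Σ₂`, `0''` has a computable `r` with `e ∈ 0''` iff `∃ n, ∀ t, r e n t`
(`exists_computable_forall_zeroDoubleJump`). The structure on `ℕ` consists, for every index `e`, of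
infinitely many isolated points and, for every `n`, infinitely many disjoint edges from a first end
of kind `2 n + 1` to a second end of kind `2 n + 2`. Unary colours determine index and kind, except
that a first end looks like an isolated point unless some colour exhibits an `s` at which `r e (n /
2) s` fails. If there is no such `s`, then `n` is live for `e`, and an isolated point of index `e`
can be embedded as a first end of an edge of kind `n`.

Because of `n / 2`, a witness `n` for `e ∈ 0''` makes the two kinds `2 n` and `2 n + 1` live.
Extensions turning one isolated point into first ends of these two kinds cannot be amalgamated: a
point is the first end of at most one edge, and second ends have distinct colours. So an isolated
point of index `e ∈ 0''` lies in no amalgamation base (`not_live_of_isAmalgamationBase`), whereas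
for `e ∉ 0''` it stays isolated under every embedding. Any member of `W` whose domain is the
isolated point of index `e` therefore decides whether `e ∈ 0''` (`reducible_of_hasCcoAP`).

For coAP, turn isolated points with a live kind into fresh first ends and add all missing ends of
edges. In the resulting saturated structure no point can gain a neighbour, so free amalgamation over
it works (`IsSaturated.isAmalgamationBase`, `hasCoAP`).

The computability side rests on the use principle: a halting oracle computation needs only a finite
prefix of the oracle, and with the prefix as a parameter it becomes an ordinary computation
(`Code.eval_plain`). -/

namespace Oracle

/-! ### Oracle programs and the use principle -/

/-- The finite partial oracle given by a list of answers. -/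
def lookup (σ : List ℕ) : ℕ →. ℕ := fun n => Part.ofOption σ[n]?

/-- The list of the first `k` values of `h`. -/
def prefixList (h : ℕ → ℕ) (k : ℕ) : List ℕ := (List.range k).map h

theorem mem_lookup_prefixList {h : ℕ → ℕ} {k n x : ℕ} :
    x ∈ lookup (prefixList h k) n ↔ n < k ∧ x = h n := by
  simp only [lookup, prefixList, Part.mem_ofOption, Option.mem_def, List.getElem?_map,
    Option.map_eq_some_iff, List.getElem?_eq_some_iff, List.length_range, List.getElem_range]
  constructor
  · rintro ⟨a, ⟨ha, rfl⟩, rfl⟩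
    exact ⟨ha, rfl⟩
  · rintro ⟨ha, rfl⟩
    exact ⟨n, ⟨ha, rfl⟩, rfl⟩

namespace Code

section Eval

variable (g : ℕ →. ℕ) (f h : Code) (f' h' : Nat.Partrec.Code) (n a : ℕ)

theorem eval_pair : (pair f h).eval g n =
    (f.eval g n).bind fun x => (h.eval g n).map (Nat.pair x) := by
  simp [eval, Seq.seq]

theorem eval_comp : (comp f h).eval g n = (h.eval g n).bind fun x => f.eval g x := rfl

theorem eval_prec_zero : (prec f h).eval g (Nat.pair a 0) = f.eval g a := by
  simp [eval]

theorem eval_prec_succ : (prec f h).eval g (Nat.pair a (n + 1)) =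
    ((prec f h).eval g (Nat.pair a n)).bind fun i => h.eval g (Nat.pair a (Nat.pair n i)) := by
  simp [eval]

theorem eval_rfind' : (rfind' f).eval g (Nat.pair a n) =
    (Nat.rfind fun k => (f.eval g (Nat.pair a (k + n))).map fun m => decide (m = 0)).map
      fun x => x + n := by
  simp [eval]

theorem mem_eval_rfind' {x : ℕ} : x ∈ (rfind' f).eval g (Nat.pair a n) ↔
    ∃ k, (0 ∈ f.eval g (Nat.pair a (k + n)) ∧
      ∀ m < k, ∃ d ∈ f.eval g (Nat.pair a (m + n)), d ≠ 0) ∧ k + n = x := by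
  rw [eval_rfind', Part.mem_map_iff]
  refine exists_congr fun k => and_congr_left fun _ => ?_
  refine (Nat.mem_rfind (p := fun k => _)).trans ?_
  simp

theorem plainEval_pair : (f'.pair h').eval n =
    (f'.eval n).bind fun x => (h'.eval n).map (Nat.pair x) := by
  simp [Nat.Partrec.Code.eval, Seq.seq]

theorem plainEval_left : Nat.Partrec.Code.left.eval n = Part.some n.unpair.1 := rfl

theorem plainEval_right : Nat.Partrec.Code.right.eval n = Part.some n.unpair.2 := rfl

theorem plainEval_comp : (f'.comp h').eval n = (h'.eval n).bind fun x => f'.eval x := rfl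

theorem plainEval_prec_succ : (f'.prec h').eval (Nat.pair a (n + 1)) =
    ((f'.prec h').eval (Nat.pair a n)).bind fun i => h'.eval (Nat.pair a (Nat.pair n i)) :=
  Nat.Partrec.Code.eval_prec_succ _ _ _ _

theorem plainEval_rfind' : (f'.rfind').eval (Nat.pair a n) =
    (Nat.rfind fun k => (f'.eval (Nat.pair a (k + n))).map fun m => decide (m = 0)).map
      fun x => x + n := by
  simp [Nat.Partrec.Code.eval]

end Eval

section Plain

/-- Re-association `⟨⟨p, a⟩, b⟩ ↦ ⟨p, ⟨a, b⟩⟩`. -/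
def assoc : Nat.Partrec.Code :=
  .pair (.comp .left .left) (.pair (.comp .right .left) .right)

/-- Re-association `⟨p, ⟨a, b⟩⟩ ↦ ⟨⟨p, a⟩, b⟩`. -/
def assocInv : Nat.Partrec.Code :=
  .pair (.pair .left (.comp .left .right)) (.comp .right .right)

theorem eval_assoc (p a b : ℕ) :
    assoc.eval (Nat.pair (Nat.pair p a) b) = Part.some (Nat.pair p (Nat.pair a b)) := by
  simp [assoc, plainEval_pair, plainEval_comp, plainEval_left, plainEval_right]

theorem eval_assocInv (p a b : ℕ) :
    assocInv.eval (Nat.pair p (Nat.pair a b)) = Part.some (Nat.pair (Nat.pair p a) b) := by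
  simp [assocInv, plainEval_pair, plainEval_comp, plainEval_left, plainEval_right]

/-- Translation of an oracle program into a program without oracle that has an additional
parameter; the program `o` answers the oracle queries, depending on the parameter. -/
def plain (o : Nat.Partrec.Code) : Code → Nat.Partrec.Code
  | zero => .zero
  | succ => .comp .succ .right
  | left => .comp .left .right
  | right => .comp .right .right
  | oracle => o
  | pair f g => .pair (plain o f) (plain o g)
  | comp f g => .comp (plain o f) (.pair .left (plain o g))
  | prec f g => .comp (.prec (plain o f) (.comp (plain o g) assoc)) assocInv
  | rfind' f => .comp (.rfind' (.comp (plain o f) assoc)) assocInv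

/-- The parameter `p` has to reach every subprogram. Recursion and search act on the second
component of their input, so `p` is moved into the first one by `assocInv` and moved back by `assoc`
before the subprogram runs. -/
theorem eval_plain {o : Nat.Partrec.Code} {p : ℕ} {g : ℕ →. ℕ}
    (ho : ∀ x, o.eval (Nat.pair p x) = g x) (c : Code) (n : ℕ) :
    (plain o c).eval (Nat.pair p n) = c.eval g n := by
  induction c generalizing n with
  | zero => rfl
  | succ => simp [plain, eval, plainEval_comp, Nat.Partrec.Code.eval]
  | left => simp [plain, eval, plainEval_comp, Nat.Partrec.Code.eval]
  | right => simp [plain, eval, plainEval_comp, Nat.Partrec.Code.eval]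
  | oracle => exact ho n
  | pair f h hf hh => simp [plain, eval_pair, plainEval_pair, hf, hh]
  | comp f h hf hh =>
    have hl : Nat.Partrec.Code.left.eval (Nat.pair p n) = Part.some p := by
      simp [Nat.Partrec.Code.eval]
    simp only [plain, eval_comp, plainEval_comp, plainEval_pair, hh, hl, Part.bind_some,
      Part.bind_map, hf]
  | prec f h hf hh =>
    obtain ⟨a, n, rfl⟩ : ∃ a m, n = Nat.pair a m := ⟨_, _, (Nat.pair_unpair n).symm⟩
    simp only [plain, plainEval_comp, eval_assocInv, Part.bind_some]
    induction n with
    | zero => rw [Nat.Partrec.Code.eval_prec_zero, eval_prec_zero, hf]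
    | succ n ih =>
      simp only [plainEval_prec_succ, eval_prec_succ, ih, plainEval_comp, eval_assoc,
        Part.bind_some, hh]
  | rfind' f hf =>
    obtain ⟨a, n, rfl⟩ : ∃ a m, n = Nat.pair a m := ⟨_, _, (Nat.pair_unpair n).symm⟩
    simp only [plain, plainEval_comp, eval_assocInv, Part.bind_some, plainEval_rfind', eval_assoc,
      hf, eval_rfind']

end Plain

theorem eval_mono {g g' : ℕ →. ℕ} (h : ∀ n, ∀ x ∈ g n, x ∈ g' n) (c : Code) :
    ∀ n, ∀ x ∈ c.eval g n, x ∈ c.eval g' n := by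
  induction c with
  | zero => exact fun _ _ => id
  | succ => exact fun _ _ => id
  | left => exact fun _ _ => id
  | right => exact fun _ _ => id
  | oracle => exact h
  | pair f k hf hk =>
    intro n x hx
    simp only [eval_pair, Part.mem_bind_iff, Part.mem_map_iff] at hx ⊢
    obtain ⟨a, ha, b, hb, rfl⟩ := hx
    exact ⟨a, hf _ _ ha, b, hk _ _ hb, rfl⟩
  | comp f k hf hk =>
    intro n x hx
    simp only [eval_comp, Part.mem_bind_iff] at hx ⊢
    obtain ⟨a, ha, hx⟩ := hx
    exact ⟨a, hk _ _ ha, hf _ _ hx⟩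
  | prec f k hf hk =>
    intro n
    obtain ⟨a, n, rfl⟩ : ∃ a m, n = Nat.pair a m := ⟨_, _, (Nat.pair_unpair n).symm⟩
    induction n with
    | zero => simpa only [eval_prec_zero] using hf a
    | succ n ih =>
      intro x hx
      simp only [eval_prec_succ, Part.mem_bind_iff] at hx ⊢
      obtain ⟨i, hi, hx⟩ := hx
      exact ⟨i, ih _ hi, hk _ _ hx⟩
  | rfind' f hf =>
    intro n x hx
    obtain ⟨i, n, rfl⟩ : ∃ a m, n = Nat.pair a m := ⟨_, _, (Nat.pair_unpair n).symm⟩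
    rw [mem_eval_rfind'] at hx ⊢
    obtain ⟨a, ⟨hb, hlt⟩, rfl⟩ := hx
    refine ⟨a, ⟨hf _ _ hb, fun m hm => ?_⟩, rfl⟩
    obtain ⟨d, hd, hd'⟩ := hlt m hm
    exact ⟨d, hf _ _ hd, hd'⟩

open Filter in
-- Half of the use principle. Having "for all large `k`" in place of "for some `k`" lets the
-- finitely many subcomputations share one prefix.
theorem eventually_mem_eval_prefixList {g : ℕ →. ℕ} {h : ℕ → ℕ} (hg : ∀ n, g n = Part.some (h n))
    (c : Code) : ∀ n, ∀ x ∈ c.eval g n,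
      ∀ᶠ k in atTop, x ∈ c.eval (lookup (prefixList h k)) n := by
  induction c with
  | zero => exact fun _ _ hx => Eventually.of_forall fun _ => hx
  | succ => exact fun _ _ hx => Eventually.of_forall fun _ => hx
  | left => exact fun _ _ hx => Eventually.of_forall fun _ => hx
  | right => exact fun _ _ hx => Eventually.of_forall fun _ => hx
  | oracle =>
    intro n x hx
    filter_upwards [eventually_gt_atTop n] with k hk
    exact mem_lookup_prefixList.2 ⟨hk, Part.mem_some_iff.1 (hg n ▸ hx)⟩
  | pair f k hf hk =>
    intro n x hx
    simp only [eval_pair, Part.mem_bind_iff, Part.mem_map_iff] at hx ⊢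
    obtain ⟨a, ha, b, hb, rfl⟩ := hx
    filter_upwards [hf _ _ ha, hk _ _ hb] with l hla hlb
    exact ⟨a, hla, b, hlb, rfl⟩
  | comp f k hf hk =>
    intro n x hx
    simp only [eval_comp, Part.mem_bind_iff] at hx ⊢
    obtain ⟨a, ha, hx⟩ := hx
    filter_upwards [hk _ _ ha, hf _ _ hx] with l hla hlx
    exact ⟨a, hla, hlx⟩
  | prec f k hf hk =>
    intro n
    obtain ⟨a, n, rfl⟩ : ∃ a m, n = Nat.pair a m := ⟨_, _, (Nat.pair_unpair n).symm⟩
    induction n with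
    | zero => simpa only [eval_prec_zero] using hf a
    | succ n ih =>
      intro x hx
      simp only [eval_prec_succ, Part.mem_bind_iff] at hx ⊢
      obtain ⟨i, hi, hx⟩ := hx
      filter_upwards [ih _ hi, hk _ _ hx] with l hli hlx
      exact ⟨i, hli, hlx⟩
  | rfind' f hf =>
    intro n x hx
    obtain ⟨i, n, rfl⟩ : ∃ a m, n = Nat.pair a m := ⟨_, _, (Nat.pair_unpair n).symm⟩
    simp only [mem_eval_rfind'] at hx ⊢
    obtain ⟨a, ⟨hb, hlt⟩, rfl⟩ := hx
    -- The failed tests before the least zero must converge as well; there are finitely many.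
    have key : ∀ᶠ k in atTop, ∀ m ∈ Finset.range a,
        ∃ d ∈ f.eval (lookup (prefixList h k)) (Nat.pair i (m + n)), d ≠ 0 := by
      rw [Filter.eventually_all_finset]
      intro m hm
      obtain ⟨d, hd, hd'⟩ := hlt m (Finset.mem_range.1 hm)
      filter_upwards [hf _ _ hd] with l hl
      exact ⟨d, hl, hd'⟩
    filter_upwards [hf _ _ hb, key] with l hlb hl
    exact ⟨a, ⟨hlb, fun m hm => hl m (Finset.mem_range.2 hm)⟩, rfl⟩

theorem mem_eval_iff_exists_prefixList {g : ℕ →. ℕ} {h : ℕ → ℕ} (hg : ∀ n, g n = Part.some (h n))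
    (c : Code) (n x : ℕ) : x ∈ c.eval g n ↔ ∃ k, x ∈ c.eval (lookup (prefixList h k)) n := by
  refine ⟨fun hx => (eventually_mem_eval_prefixList hg c n x hx).exists, fun ⟨k, hk⟩ => ?_⟩
  refine eval_mono (fun m y hy => ?_) c n x hk
  rw [hg]
  exact Part.mem_some_iff.2 (mem_lookup_prefixList.1 hy).2

theorem exists_eval_eq {g f : ℕ →. ℕ} (hf : Nat.RecursiveIn {g} f) : ∃ c : Code, c.eval g = f := by
  induction hf with
  | zero => exact ⟨zero, rfl⟩
  | succ => exact ⟨succ, rfl⟩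
  | left => exact ⟨left, rfl⟩
  | right => exact ⟨right, rfl⟩
  | oracle g' hg => exact ⟨oracle, (Set.mem_singleton_iff.1 hg).symm⟩
  | pair _ _ hf hh =>
    obtain ⟨cf, rfl⟩ := hf
    obtain ⟨ch, rfl⟩ := hh
    exact ⟨pair cf ch, rfl⟩
  | comp _ _ hf hh =>
    obtain ⟨cf, rfl⟩ := hf
    obtain ⟨ch, rfl⟩ := hh
    exact ⟨comp cf ch, rfl⟩
  | prec _ _ hf hh =>
    obtain ⟨cf, rfl⟩ := hf
    obtain ⟨ch, rfl⟩ := hh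
    exact ⟨prec cf ch, rfl⟩
  | rfind _ hf =>
    obtain ⟨cf, rfl⟩ := hf
    -- `rfind'` searches from a given start, here `0`; `pair left right` is the identity.
    refine ⟨comp (rfind' cf) (pair (pair left right) zero), funext fun n => ?_⟩
    simp [eval, Seq.seq, pure, PFun.pure, Part.map_id']

end Code

end Oracle

/-! ### Searches relative to an oracle -/

namespace Oracle

open Encodable

/-- Used as the argument `o` of `Code.plain`, with the parameter coding a finite list of answers. -/
theorem exists_code_lookup : ∃ o : Nat.Partrec.Code, ∀ (σ : List ℕ) (x : ℕ),
    o.eval (Nat.pair (encode σ) x) = lookup σ x := by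
  have hp : Partrec fun n : ℕ =>
      (Part.ofOption (Denumerable.ofNat (List ℕ) n.unpair.1)[n.unpair.2]? : Part ℕ) := by
    refine Computable.ofOption (Computable.list_getElem?.comp ?_ ?_)
    · exact (Computable.ofNat (List ℕ)).comp (Computable.fst.comp Computable.unpair)
    · exact Computable.snd.comp Computable.unpair
  obtain ⟨o, ho⟩ := Nat.Partrec.Code.exists_code.1 (Partrec.nat_iff.1 hp)
  refine ⟨o, fun σ x => ?_⟩
  rw [ho]
  simp [lookup]

section Total

variable {O : Set (ℕ →. ℕ)} {F : ℕ →. ℕ} {f h : ℕ → ℕ}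

theorem recursiveIn_comp_total (hF : Nat.RecursiveIn O F)
    (hh : Nat.RecursiveIn O fun n => Part.some (h n)) : Nat.RecursiveIn O fun n => F (h n) :=
  (Nat.RecursiveIn.comp hF hh).of_eq fun n => Part.bind_some (h n) F

theorem recursiveIn_pair_total (hf : Nat.RecursiveIn O fun n => Part.some (f n))
    (hh : Nat.RecursiveIn O fun n => Part.some (h n)) :
    Nat.RecursiveIn O fun n => Part.some (Nat.pair (f n) (h n)) :=
  (Nat.RecursiveIn.pair hf hh).of_eq fun n => by simp [Seq.seq]

theorem recursiveIn_of_computable (hf : Computable f) :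
    Nat.RecursiveIn O fun n => Part.some (f n) :=
  (Partrec.nat_iff.1 hf.partrec).recursiveIn

end Total

theorem computable_evaln_isSome {α : Type} [Primcodable α] {s : α → ℕ}
    {c : α → Nat.Partrec.Code} {n : α → ℕ} (hs : Computable s) (hc : Computable c)
    (hn : Computable n) : Computable fun a => (Nat.Partrec.Code.evaln (s a) (c a) (n a)).isSome :=
  (Primrec.option_isSome.comp Nat.Partrec.Code.primrec_evaln).to_comp.comp ((hs.pair hc).pair hn)

theorem computable_unpair_fst : Computable fun m : ℕ => m.unpair.1 :=
  Computable.fst.comp Computable.unpair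

theorem computable_unpair_snd : Computable fun m : ℕ => m.unpair.2 :=
  Computable.snd.comp Computable.unpair

theorem recursiveIn_prefixList {g : ℕ →. ℕ} {h : ℕ → ℕ} (hg : ∀ n, g n = Part.some (h n)) :
    Nat.RecursiveIn {g} fun k => Part.some (encode (prefixList h k)) := by
  let app : ℕ → ℕ := fun n => encode (Denumerable.ofNat (List ℕ) n.unpair.1 ++ [n.unpair.2])
  have happ : Computable app := Computable.encode.comp (Computable.list_concat.comp
    ((Computable.ofNat (List ℕ)).comp computable_unpair_fst) computable_unpair_snd)
  have hgr : Nat.RecursiveIn {g} fun n => Part.some (h n) :=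
    (Nat.RecursiveIn.oracle g (Set.mem_singleton g)).of_eq hg
  have hstep : Nat.RecursiveIn {g} fun n =>
      Part.some (app (Nat.pair n.unpair.2.unpair.2 (h n.unpair.2.unpair.1))) :=
    recursiveIn_comp_total (F := fun n => Part.some (app n)) (recursiveIn_of_computable happ)
      (recursiveIn_pair_total
        (recursiveIn_of_computable (computable_unpair_snd.comp computable_unpair_snd))
        (recursiveIn_comp_total (F := fun n => Part.some (h n)) hgr
          (recursiveIn_of_computable (computable_unpair_fst.comp computable_unpair_snd))))
  have hrec := recursiveIn_comp_total (h := fun k => Nat.pair 0 k)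
    (Nat.RecursiveIn.prec (O := {g}) (f := fun _ => 0) .zero hstep)
    (recursiveIn_of_computable (Primrec₂.natPair.comp (Primrec.const 0) Primrec.id).to_comp)
  refine hrec.of_eq fun k => ?_
  simp only [Nat.unpair_pair]
  induction k with
  | zero => simp [prefixList]; rfl
  | succ k ih =>
    simp only [ih]
    simp [app, prefixList, List.range_succ]

/-- Search for the least `t` that passes a computable test, which uses a prefix of the oracle of
length `t.unpair.1`. -/
theorem recursiveIn_search {g : ℕ →. ℕ} {h : ℕ → ℕ} (hg : ∀ n, g n = Part.some (h n))
    {F G f : ℕ → ℕ} (hF : Computable F) (hG : Computable G)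
    (hex : ∀ e, ∃ t, F (Nat.pair (encode (prefixList h t.unpair.1)) (Nat.pair e t)) = 0)
    (hf : ∀ e t, F (Nat.pair (encode (prefixList h t.unpair.1)) (Nat.pair e t)) = 0 → G t = f e) :
    Nat.RecursiveIn {g} fun e => Part.some (f e) := by
  have hF' : Nat.RecursiveIn {g} fun m => Part.some
      (F (Nat.pair (encode (prefixList h m.unpair.2.unpair.1)) m)) :=
    recursiveIn_comp_total (F := fun n => Part.some (F n)) (recursiveIn_of_computable hF)
      (recursiveIn_pair_total
        (recursiveIn_comp_total (F := fun k => Part.some (encode (prefixList h k)))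
          (recursiveIn_prefixList hg)
          (recursiveIn_of_computable (computable_unpair_fst.comp computable_unpair_snd)))
        (recursiveIn_of_computable Computable.id))
  refine (Nat.RecursiveIn.comp (f := fun t => Part.some (G t)) (recursiveIn_of_computable hG)
    (Nat.RecursiveIn.rfind hF')).of_eq fun e => ?_
  obtain ⟨t, ht⟩ := Part.dom_iff_mem.1 ((Nat.rfind_dom (p := fun t => (fun m => decide (m = 0)) <$>
    Part.some (F (Nat.pair (encode (prefixList h (Nat.pair e t).unpair.2.unpair.1))
      (Nat.pair e t))))).2 (by
      obtain ⟨t, ht⟩ := hex e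
      exact ⟨t, by simp [ht], fun _ => trivial⟩))
  have ht' := Nat.rfind_spec ht
  simp only [Nat.unpair_pair, Part.map_eq_map, Part.map_some, Part.mem_some_iff] at ht'
  refine (congrArg (fun x : Part ℕ => x.bind fun t => Part.some (G t))
    (Part.eq_some_iff.2 ht)).trans ?_
  exact (Part.bind_some _ _).trans (congrArg Part.some (hf e t (of_decide_eq_true ht'.symm)))

/-- A total function is `S`-computable if its values can be read off from the members of an
`S`-c.e. predicate. -/
theorem recursiveIn_of_enumerable {α : Type} [Primcodable α] {S : Set ℕ} {p : α → Prop}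
    (hp : Enumerable S p) {q : ℕ → α → Bool} (hq : Computable₂ q) {out : α → ℕ}
    (hout : Computable out) {f : ℕ → ℕ} (hex : ∀ e, ∃ a, p a ∧ q e a = true)
    (hf : ∀ e a, p a → q e a = true → out a = f e) :
    Nat.RecursiveIn {chi S} fun e => Part.some (f e) := by
  obtain ⟨o, ho⟩ := exists_code_lookup
  obtain ⟨c, hc⟩ := Code.exists_eval_eq hp
  set h : ℕ → ℕ := S.indicator 1
  have hg : ∀ n, chi S n = Part.some (h n) := fun _ => rfl
  obtain ⟨pc, hpc⟩ : ∃ pc, ∀ (σ : List ℕ) n, Nat.Partrec.Code.eval pc (Nat.pair (encode σ) n) =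
      c.eval (lookup σ) n := ⟨Code.plain o c, fun σ n => Code.eval_plain (ho σ) c n⟩
  -- By the use principle, membership is witnessed by a prefix length `k` and a step bound `s`, and
  -- both can be searched for.
  have key : ∀ a : α, p a ↔ ∃ k s,
      (Nat.Partrec.Code.evaln s pc (Nat.pair (encode (prefixList h k)) (encode a))).isSome := by
    intro a
    have h1 : p a ↔ ∃ x, x ∈ c.eval (chi S) (encode a) := by
      rw [hc]
      simp only [encodek, Part.coe_some, Part.bind_some, Part.mem_map_iff, Part.mem_assert_iff]
      constructor
      · exact fun h => ⟨_, (), ⟨h, Part.mem_some _⟩, rfl⟩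
      · rintro ⟨_, _, ⟨h, _⟩, _⟩
        exact h
    rw [h1]
    simp only [Code.mem_eval_iff_exists_prefixList hg, ← hpc,
      Nat.Partrec.Code.evaln_complete, Option.isSome_iff_exists]
    constructor
    · rintro ⟨x, k, s, hx⟩
      exact ⟨k, s, x, hx⟩
    · rintro ⟨k, s, x, hx⟩
      exact ⟨x, k, s, hx⟩
  -- `m` codes `⟨u, e, k, s, n⟩`
  let F : ℕ → ℕ := fun m => Option.casesOn (decode₂ α m.unpair.2.unpair.2.unpair.2.unpair.2) 1
    fun a => cond (q m.unpair.2.unpair.1 a && (Nat.Partrec.Code.evaln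
      m.unpair.2.unpair.2.unpair.2.unpair.1 pc
      (Nat.pair m.unpair.1 m.unpair.2.unpair.2.unpair.2.unpair.2)).isSome) 0 1
  have hr := computable_unpair_snd
  have hl := computable_unpair_fst
  have hF : Computable F := by
    have hr4 : Computable fun m : ℕ => m.unpair.2.unpair.2.unpair.2.unpair.2 :=
      hr.comp (hr.comp (hr.comp hr))
    have hs : Computable fun m : ℕ => m.unpair.2.unpair.2.unpair.2.unpair.1 :=
      hl.comp (hr.comp (hr.comp hr))
    have hp : Computable fun m : ℕ => Nat.pair m.unpair.1 m.unpair.2.unpair.2.unpair.2.unpair.2 :=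
      Primrec₂.natPair.to_comp.comp hl hr4
    have hev : Computable fun m : ℕ => (Nat.Partrec.Code.evaln
        m.unpair.2.unpair.2.unpair.2.unpair.1 pc
        (Nat.pair m.unpair.1 m.unpair.2.unpair.2.unpair.2.unpair.2)).isSome :=
      computable_evaln_isSome hs (Computable.const pc) hp
    refine Computable.option_casesOn
      (Primrec.decode₂.to_comp.comp hr4) (Computable.const 1) ?_
    exact Computable.cond (Primrec.and.to_comp.comp
      (hq.comp ((hl.comp hr).comp Computable.fst) Computable.snd) (hev.comp Computable.fst))
      (Computable.const 0) (Computable.const 1)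
  let G : ℕ → ℕ := fun t => Option.casesOn (decode₂ α t.unpair.2.unpair.2) 0 out
  have hG : Computable G := Computable.option_casesOn
    (Primrec.decode₂.to_comp.comp (hr.comp hr)) (Computable.const 0) (hout.comp Computable.snd)
  have hval : ∀ e t, F (Nat.pair (encode (prefixList h t.unpair.1)) (Nat.pair e t)) = 0 ↔
      ∃ a, decode₂ α t.unpair.2.unpair.2 = some a ∧ q e a = true ∧
        (Nat.Partrec.Code.evaln t.unpair.2.unpair.1 pc
          (Nat.pair (encode (prefixList h t.unpair.1)) t.unpair.2.unpair.2)).isSome = true := by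
    intro e t
    simp only [F, Nat.unpair_pair]
    cases decode₂ α t.unpair.2.unpair.2 with
    | none => simp
    | some a =>
      simp only [Option.some.injEq, exists_eq_left']
      generalize q e a = b1
      generalize (Nat.Partrec.Code.evaln _ _ _).isSome = b2
      cases b1 <;> cases b2 <;> simp
  refine recursiveIn_search hg hF hG (fun e => ?_) fun e t ht => ?_
  · obtain ⟨a, ha, hqa⟩ := hex e
    obtain ⟨k, s, hks⟩ := (key a).1 ha
    refine ⟨Nat.pair k (Nat.pair s (encode a)), (hval _ _).2 ⟨a, ?_, hqa, ?_⟩⟩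
    · simp
    · simpa using hks
  · obtain ⟨a, ha, hqa, hev⟩ := (hval e t).1 ht
    -- `decode₂` succeeds only at the number `encode a`, so the computation that was tested is the
    -- one on `a`.
    have hpa : p a := (key a).2 ⟨_, _, by rwa [mem_decode₂.1 ha]⟩
    simp only [G, ha]
    exact hf e a hpa hqa

end Oracle

/-! ### The double jump is `Σ₂` -/

namespace Oracle

open Encodable Filter

/-- Course-of-values recursion: `Code.ofNat` builds a program from programs with smaller numbers,
and `plain` commutes with the constructors. -/
theorem primrec_plain_ofNat (o : Nat.Partrec.Code) :
    Primrec fun e => Code.plain o (Code.ofNat e) := by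
  let tbl : List Nat.Partrec.Code := [Code.plain o .zero, Code.plain o .succ, Code.plain o .left,
    Code.plain o .right, Code.plain o .oracle]
  let stp : List Nat.Partrec.Code × (ℕ × (Nat.Partrec.Code × Nat.Partrec.Code)) →
      Option Nat.Partrec.Code := fun x =>
    cond x.2.1.bodd
      (cond x.2.1.div2.bodd
        (x.1[x.2.1.div2.div2]?.map fun f =>
          .comp (.rfind' (.comp f Code.assoc)) Code.assocInv)
        (some (.comp (.prec x.2.2.1 (.comp x.2.2.2 Code.assoc)) Code.assocInv)))
      (cond x.2.1.div2.bodd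
        (some (.comp x.2.2.1 (.pair .left x.2.2.2)))
        (some (.pair x.2.2.1 x.2.2.2)))
  let G : List Nat.Partrec.Code → Option Nat.Partrec.Code := fun L =>
    -- `L` lists the values at all smaller numbers, so its length is the current number. Beyond the
    -- five tabulated atoms, `L.length - 5` is the `n` of the clause `n + 5` of `Code.ofNat`.
    Option.casesOn tbl[L.length]?
      (L[(L.length - 5).div2.div2.unpair.1]?.bind fun f =>
        L[(L.length - 5).div2.div2.unpair.2]?.bind fun h =>
          stp (L, (L.length - 5, (f, h)))) some
  have hstp : Primrec stp := by
    have hn : Primrec fun x : List Nat.Partrec.Code × (ℕ × (Nat.Partrec.Code × Nat.Partrec.Code)) =>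
      x.2.1 := Primrec.fst.comp Primrec.snd
    have hf : Primrec fun x : List Nat.Partrec.Code × (ℕ × (Nat.Partrec.Code × Nat.Partrec.Code)) =>
      x.2.2.1 := Primrec.fst.comp (Primrec.snd.comp Primrec.snd)
    have hh : Primrec fun x : List Nat.Partrec.Code × (ℕ × (Nat.Partrec.Code × Nat.Partrec.Code)) =>
      x.2.2.2 := Primrec.snd.comp (Primrec.snd.comp Primrec.snd)
    have hb := Primrec.nat_bodd.comp (Primrec.nat_div2.comp hn)
    refine Primrec.cond (Primrec.nat_bodd.comp hn) (Primrec.cond hb ?_ ?_) (Primrec.cond hb ?_ ?_)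
    · refine Primrec.option_map (Primrec.list_getElem?.comp Primrec.fst
        (Primrec.nat_div2.comp (Primrec.nat_div2.comp hn))) ?_
      exact Nat.Partrec.Code.primrec₂_comp.comp (Nat.Partrec.Code.primrec_rfind'.comp
        (Nat.Partrec.Code.primrec₂_comp.comp Primrec.snd (Primrec.const _))) (Primrec.const _)
    · exact Primrec.option_some.comp (Nat.Partrec.Code.primrec₂_comp.comp
        (Nat.Partrec.Code.primrec₂_prec.comp hf
          (Nat.Partrec.Code.primrec₂_comp.comp hh (Primrec.const _))) (Primrec.const _))
    · exact Primrec.option_some.comp (Nat.Partrec.Code.primrec₂_comp.comp hf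
        (Nat.Partrec.Code.primrec₂_pair.comp (Primrec.const _) hh))
    · exact Primrec.option_some.comp (Nat.Partrec.Code.primrec₂_pair.comp hf hh)
  have hG : Primrec G := by
    have hm : Primrec fun L : List Nat.Partrec.Code => (L.length - 5).div2.div2.unpair :=
      Primrec.unpair.comp (Primrec.nat_div2.comp (Primrec.nat_div2.comp
        (Primrec.nat_sub.comp Primrec.list_length (Primrec.const 5))))
    refine Primrec.option_casesOn
      (Primrec.list_getElem?.comp (Primrec.const tbl) Primrec.list_length) ?_
      (Primrec.option_some.comp Primrec.snd)
    refine Primrec.option_bind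
      (Primrec.list_getElem?.comp Primrec.id (Primrec.fst.comp hm)) ?_
    refine Primrec.option_bind
      (Primrec.list_getElem?.comp Primrec.fst ((Primrec.snd.comp hm).comp Primrec.fst)) ?_
    have hL : Primrec fun x : (List Nat.Partrec.Code × Nat.Partrec.Code) × Nat.Partrec.Code =>
      x.1.1 := Primrec.fst.comp Primrec.fst
    exact hstp.comp (hL.pair ((Primrec.nat_sub.comp (Primrec.list_length.comp hL)
      (Primrec.const 5)).pair ((Primrec.snd.comp Primrec.fst).pair Primrec.snd)))
  have hrec := Primrec.nat_strong_rec (α := Unit) (fun _ n => Code.plain o (Code.ofNat n))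
    (g := fun _ L => G L) (hG.comp Primrec.snd) fun _ n => by
      match n with
      | 0 => simp [G, tbl, Code.ofNat]
      | 1 => simp [G, tbl, Code.ofNat]
      | 2 => simp [G, tbl, Code.ofNat]
      | 3 => simp [G, tbl, Code.ofNat]
      | 4 => simp [G, tbl, Code.ofNat]
      | n + 5 =>
        have h₁ := Nat.unpair_left_le n.div2.div2
        have h₂ := Nat.unpair_right_le n.div2.div2
        have h₃ : n.div2.div2 ≤ n := by
          simp only [Nat.div2_val]
          omega
        have e₁ : n.div2.div2.unpair.1 < n + 5 := by omega
        have e₂ : n.div2.div2.unpair.2 < n + 5 := by omega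
        have e₃ : n.div2.div2 < n + 5 := by omega
        simp only [G, tbl, stp, List.length_map, List.length_range, List.getElem?_map,
          List.getElem?_range e₁, List.getElem?_range e₂, List.getElem?_range e₃,
          Nat.add_sub_cancel, Option.map_some, Option.bind_some]
        rw [Code.ofNat]
        cases n.bodd <;> cases n.div2.bodd <;> simp [Code.plain]
  exact hrec.comp (Primrec.const ()) Primrec.id

theorem primrec_evaln_isSome {α : Type} [Primcodable α] {s : α → ℕ}
    {c : α → Nat.Partrec.Code} {n : α → ℕ} (hs : Primrec s) (hc : Primrec c)
    (hn : Primrec n) : Primrec fun a => (Nat.Partrec.Code.evaln (s a) (c a) (n a)).isSome :=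
  (Primrec.option_isSome.comp Nat.Partrec.Code.primrec_evaln).comp ((hs.pair hc).pair hn)

theorem eval_dom_iff_evaln_isSome (c : Nat.Partrec.Code) (n : ℕ) :
    (c.eval n).Dom ↔ ∃ s, (Nat.Partrec.Code.evaln s c n).isSome = true := by
  simp only [Part.dom_iff_mem, Nat.Partrec.Code.evaln_complete, Option.isSome_iff_exists]
  exact exists_comm

/-- The approximation of the characteristic function of `0'` after `u` steps. -/
def jumpApprox (u i : ℕ) : ℕ :=
  cond (Nat.Partrec.Code.evaln u (Code.plain .zero (Code.ofNat i)) (Nat.pair 0 i)).isSome 1 0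

theorem primrec_jumpApprox : Primrec₂ jumpApprox :=
  Primrec.cond (primrec_evaln_isSome Primrec.fst ((primrec_plain_ofNat _).comp Primrec.snd)
    (Primrec₂.natPair.comp (Primrec.const 0) Primrec.snd)) (Primrec.const 1) (Primrec.const 0)

/-- The empty oracle answers every query by `0`, so `.zero` simulates it; the parameter `0` is
arbitrary. -/
theorem mem_jump_empty_iff (i : ℕ) : i ∈ jump ∅ ↔
    ∃ u, (Nat.Partrec.Code.evaln u (Code.plain .zero (Code.ofNat i)) (Nat.pair 0 i)).isSome := by
  rw [← eval_dom_iff_evaln_isSome, Code.eval_plain (g := chi ∅)]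
  · rfl
  · intro x
    simp [chi, Nat.Partrec.Code.eval]
    rfl

theorem eventually_jumpApprox_eq (i : ℕ) :
    ∀ᶠ u in atTop, jumpApprox u i = (jump ∅).indicator 1 i := by
  by_cases hi : i ∈ jump ∅
  · obtain ⟨u, hu⟩ := (mem_jump_empty_iff i).1 hi
    filter_upwards [eventually_ge_atTop u] with v hv
    obtain ⟨x, hx⟩ := Option.isSome_iff_exists.1 hu
    have := Nat.Partrec.Code.evaln_mono hv hx
    simp [jumpApprox, Option.mem_def.1 this, hi]
  · refine Eventually.of_forall fun u => ?_
    have := Bool.eq_false_iff.2 fun h => hi ((mem_jump_empty_iff i).2 ⟨u, h⟩)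
    simp [jumpApprox, hi, this]

theorem eventually_prefixList_jumpApprox_eq (k : ℕ) :
    ∀ᶠ u in atTop, prefixList (jumpApprox u) k = prefixList ((jump ∅).indicator 1) k := by
  have : ∀ᶠ u in atTop, ∀ i ∈ Finset.range k, jumpApprox u i = (jump ∅).indicator 1 i :=
    (Filter.eventually_all_finset _).2 fun i _ => eventually_jumpApprox_eq i
  filter_upwards [this] with u hu
  exact List.map_congr_left fun i hi => hu i (by simpa using hi)

theorem primrec_prefixList_jumpApprox :
    Primrec₂ fun u k => prefixList (jumpApprox u) k :=
  Primrec.list_map (Primrec.list_range.comp Primrec.snd)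
    (primrec_jumpApprox.comp (Primrec.fst.comp Primrec.fst) Primrec.snd)

/-- `0''` is `Σ₂`. -/
theorem exists_computable_forall_zeroDoubleJump : ∃ r : ℕ → ℕ → ℕ → Bool,
    (Computable fun x : ℕ × ℕ × ℕ => r x.1 x.2.1 x.2.2) ∧
      ∀ e, e ∈ zeroDoubleJump ↔ ∃ n, ∀ t, r e n t = true := by
  obtain ⟨o, ho⟩ := exists_code_lookup
  let P : ℕ → ℕ → List ℕ := fun u k => prefixList (jumpApprox u) k
  -- The witness `n` codes `⟨k, s, u⟩`: the computation halts within `s` steps on the stage-`u`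
  -- approximation to the first `k` values of `0'`, and this approximation is the same at stage `u +
  -- t`.
  let r : ℕ → ℕ → ℕ → Bool := fun e n t =>
    (Nat.Partrec.Code.evaln n.unpair.2.unpair.1 (Code.plain o (Code.ofNat e))
      (Nat.pair (encode (P n.unpair.2.unpair.2 n.unpair.1)) e)).isSome &&
    decide (P (n.unpair.2.unpair.2 + t) n.unpair.1 = P n.unpair.2.unpair.2 n.unpair.1)
  refine ⟨r, Primrec.to_comp ?_, fun e => ?_⟩
  · have hn : Primrec fun x : ℕ × ℕ × ℕ => x.2.1.unpair :=
      Primrec.unpair.comp (Primrec.fst.comp Primrec.snd)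
    have hn2 : Primrec fun x : ℕ × ℕ × ℕ => x.2.1.unpair.2.unpair :=
      Primrec.unpair.comp (Primrec.snd.comp hn)
    have hP : Primrec fun x : ℕ × ℕ × ℕ => P x.2.1.unpair.2.unpair.2 x.2.1.unpair.1 :=
      primrec_prefixList_jumpApprox.comp (Primrec.snd.comp hn2) (Primrec.fst.comp hn)
    have hP' : Primrec fun x : ℕ × ℕ × ℕ =>
        P (x.2.1.unpair.2.unpair.2 + x.2.2) x.2.1.unpair.1 :=
      primrec_prefixList_jumpApprox.comp (Primrec.nat_add.comp (Primrec.snd.comp hn2)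
        (Primrec.snd.comp Primrec.snd)) (Primrec.fst.comp hn)
    refine Primrec.and.comp ?_ (Primrec.eq.decide.comp hP' hP)
    exact primrec_evaln_isSome (Primrec.fst.comp hn2) ((primrec_plain_ofNat o).comp Primrec.fst)
      (Primrec₂.natPair.comp (Primrec.encode.comp hP) Primrec.fst)
  · have h1 : e ∈ zeroDoubleJump ↔ ∃ k s, (Nat.Partrec.Code.evaln s (Code.plain o (Code.ofNat e))
        (Nat.pair (encode (prefixList ((jump ∅).indicator 1) k)) e)).isSome = true := by
      change ((Code.ofNat e).eval (chi (jump ∅)) e).Dom ↔ _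
      have hc := Code.mem_eval_iff_exists_prefixList (g := chi (jump ∅))
        (h := (jump ∅).indicator 1) (fun _ => rfl)
      simp only [← eval_dom_iff_evaln_isSome, Code.eval_plain (ho _), Part.dom_iff_mem, hc]
      exact exists_comm
    rw [h1]
    constructor
    · rintro ⟨k, s, hks⟩
      obtain ⟨u, hu⟩ := eventually_atTop.1 (eventually_prefixList_jumpApprox_eq k)
      refine ⟨Nat.pair k (Nat.pair s u), fun t => ?_⟩
      simp [r, P, hu u le_rfl, hu (u + t) (Nat.le_add_right _ _), hks]
    · rintro ⟨n, hn⟩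
      simp only [r, Bool.and_eq_true, decide_eq_true_eq] at hn
      obtain ⟨u, hu⟩ := eventually_atTop.1 (eventually_prefixList_jumpApprox_eq n.unpair.1)
      refine ⟨n.unpair.1, n.unpair.2.unpair.1, ?_⟩
      -- A stage late enough to be correct; by `hn` it agrees with the stage of the witness.
      rw [← hu (n.unpair.2.unpair.2 + u) (Nat.le_add_left _ _)]
      have h2 : prefixList _ _ = prefixList _ _ := (hn u).2
      rw [h2]
      exact (hn u).1

end Oracle

/-! ### Coloured matchings -/

namespace Matching

open CategoryTheory

/-- The element with given index, kind and copy number. -/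
def elt (e m k : ℕ) : ℕ := Nat.pair e (Nat.pair m k)

def idx (x : ℕ) : ℕ := x.unpair.1

/-- The kind of an element: `0` for isolated elements, `2 n + 1` and `2 n + 2` for the two ends
of an edge. -/
def kind (x : ℕ) : ℕ := x.unpair.2.unpair.1

def copy (x : ℕ) : ℕ := x.unpair.2.unpair.2

@[simp] theorem idx_elt (e m k : ℕ) : idx (elt e m k) = e := by simp [idx, elt]

@[simp] theorem kind_elt (e m k : ℕ) : kind (elt e m k) = m := by simp [kind, elt]

@[simp] theorem copy_elt (e m k : ℕ) : copy (elt e m k) = k := by simp [copy, elt]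

theorem elt_eta (x : ℕ) : elt (idx x) (kind x) (copy x) = x := by simp [elt, idx, kind, copy]

theorem ext {x y : ℕ} (h₁ : idx x = idx y) (h₂ : kind x = kind y) (h₃ : copy x = copy y) :
    x = y := by
  rw [← elt_eta x, ← elt_eta y, h₁, h₂, h₃]

/-- The edge relation. -/
def edge (x y : ℕ) : Bool :=
  decide (idx x = idx y) && decide (copy x = copy y) && decide (kind y = kind x + 1) &&
    (kind x).bodd

theorem edge_iff {x y : ℕ} : edge x y = true ↔
    idx x = idx y ∧ copy x = copy y ∧ kind y = kind x + 1 ∧ kind x % 2 = 1 := by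
  have : (kind x).bodd = true ↔ kind x % 2 = 1 := by
    rw [Nat.mod_two_of_bodd]
    cases (kind x).bodd <;> simp
  simp [edge, this, and_assoc]

theorem edge_right_unique {x y z : ℕ} (h : edge x y = true) (h' : edge x z = true) : y = z := by
  rw [edge_iff] at h h'
  apply ext <;> omega

/-- The other end of the edge at `x`. -/
def mate (x : ℕ) : ℕ :=
  elt (idx x) (if kind x = 0 then 0 else if kind x % 2 = 1 then kind x + 1 else kind x - 1) (copy x)

theorem kind_mate (x : ℕ) : kind (mate x) =
    if kind x = 0 then 0 else if kind x % 2 = 1 then kind x + 1 else kind x - 1 := kind_elt _ _ _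

theorem mate_mate (x : ℕ) : mate (mate x) = x := by
  apply ext
  · simp [mate]
  · obtain h | ⟨n, h⟩ | ⟨n, h⟩ :
        kind x = 0 ∨ (∃ n, kind x = 2 * n + 1) ∨ ∃ n, kind x = 2 * n + 2 := by
      rcases Nat.even_or_odd' (kind x) with ⟨n | n, h | h⟩
      · exact .inl h
      · exact .inr (.inl ⟨_, h⟩)
      · exact .inr (.inr ⟨n, by omega⟩)
      · exact .inr (.inl ⟨_, h⟩)
    · simp [kind_mate, h]
    · simp [kind_mate, h, Nat.add_mod]
    · simp [kind_mate, h, Nat.add_mod]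
  · simp [mate]

theorem mate_of_kind_eq_zero {x : ℕ} (h : kind x = 0) : mate x = x :=
  ext (idx_elt _ _ _) (by rw [kind_mate, if_pos h, h]) (copy_elt _ _ _)

/-- Every point of nonzero kind has exactly one neighbour, so edges up to orientation are governed
by the involution `mate`. -/
theorem edge_or_edge_iff {x y : ℕ} :
    (edge x y = true ∨ edge y x = true) ↔ kind x ≠ 0 ∧ y = mate x := by
  constructor
  · intro h
    simp only [edge_iff] at h
    refine ⟨by omega, ext ?_ ?_ ?_⟩
    · simp only [mate, idx_elt]
      omega
    · rw [kind_mate]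
      split_ifs <;> omega
    · simp only [mate, copy_elt]
      omega
  · rintro ⟨hx, rfl⟩
    simp only [edge_iff, kind_mate, hx]
    simp only [mate, idx_elt, copy_elt]
    split_ifs <;> simp <;> omega

section Language

variable (r : ℕ → ℕ → ℕ → Bool)

/-- The unary relations: they determine the index and the kind of an element, except that an
isolated element with index `e` has the same type as an element with index `e` and kind
`2 n + 1` if `r e (n / 2) s` is true for all `s`. -/
def pred (q x : ℕ) : Bool :=
  -- Three families of colours. Family `0` names the index of isolated points and first ends, family
  -- `1` the index and kind of second ends. Family `2` marks a first end of kind `m` with each `s`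
  -- at which `r` fails. Halving `2 n + 1` twice gives `n / 2`, so the kinds `2 n` and `2 n + 1`
  -- share the test for `n`.
  (decide (q.unpair.1 = 0) && decide (q.unpair.2 = idx x) && (decide (kind x = 0) || (kind x).bodd))
  || (decide (q.unpair.1 = 1) && decide (q.unpair.2 = Nat.pair (idx x) (kind x)) &&
    !(decide (kind x = 0) || (kind x).bodd))
  || (decide (q.unpair.1 = 2) && decide (q.unpair.2.unpair.1 = kind x) && (kind x).bodd &&
    !r (idx x) (kind x).div2.div2 q.unpair.2.unpair.2)

def SameType (x y : ℕ) : Prop := ∀ q, pred r q x = pred r q y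

/-- The elements with index `e` and kind `2 n + 1` have the type of the isolated elements. -/
def Live (e n : ℕ) : Prop := ∀ s, r e (n / 2) s = true

variable {r}

theorem sameType_of_eq {x y : ℕ} (h₁ : idx x = idx y) (h₂ : kind x = kind y) : SameType r x y :=
  fun q => by simp only [pred, h₁, h₂]

theorem Live.sameType {x y n : ℕ} (h : Live r (idx x) n) (hx : kind x = 0)
    (h₁ : idx x = idx y) (h₂ : kind y = 2 * n + 1) : SameType r x y := by
  intro q
  have hb : (2 * n + 1).bodd = true := by simp
  have hd : (2 * n + 1).div2.div2 = n / 2 := by simp only [Nat.div2_val]; omega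
  simp only [pred, hx, h₂, hb, hd, ← h₁, h _]
  simp

theorem SameType.idx_eq {x y : ℕ} (h : SameType r x y) (hx : kind x = 0) : idx y = idx x := by
  have := h (Nat.pair 0 (idx x))
  simp [pred, hx] at this
  exact this.1.symm

/-- Family `0` excludes second ends. If `y` is a first end, the family `2` colours of its kind are
absent from the isolated `x`, hence from `y`, so `r` never fails. -/
theorem SameType.kind_of_isolated {x y : ℕ} (h : SameType r x y) (hx : kind x = 0) :
    kind y = 0 ∨ ∃ n, kind y = 2 * n + 1 ∧ Live r (idx x) n := by
  have h0 := h (Nat.pair 0 (idx x))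
  simp [pred, hx] at h0
  refine h0.2.imp id fun hb => ⟨kind y / 2, ?_, fun s => ?_⟩
  · have := Nat.mod_two_of_bodd (kind y)
    rw [hb] at this
    simp at this
    omega
  · have h2 := h (Nat.pair 2 (Nat.pair (kind y) s))
    simpa [pred, hx, hb, ← h0.1, Nat.div2_val] using h2

theorem SameType.kind_eq {x y n : ℕ} (h : SameType r x y) (hx : kind x = 2 * n + 2) :
    kind y = kind x := by
  have := h (Nat.pair 1 (Nat.pair (idx x) (kind x)))
  simp [pred, hx] at this
  rw [hx, this.1.2]

variable (r)

/-- `f` preserves and reflects the relations of the structure on the natural numbers. -/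
structure IsEmb {A : Set ℕ} (f : A → ℕ) : Prop where
  injective : Function.Injective f
  sameType : ∀ x : A, SameType r x (f x)
  edge_eq : ∀ x y : A, edge x y = edge (f x) (f y)

/-- The relation symbols. -/
inductive Symb : ℕ → Type
  | unary (q : ℕ) : Symb 1
  | edge : Symb 2

/-- The language of coloured matchings; the colours of the natural numbers depend on `r`. -/
def lang (_r : ℕ → ℕ → ℕ → Bool) : FirstOrder.Language.{0, 0} := ⟨fun _ => Empty, Symb⟩

def relMap {n : ℕ} (R : Symb n) (x : Fin n → ℕ) : Prop :=
  match n, R, x with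
  | _, .unary q, x => pred r q (x 0) = true
  | _, .edge, x => edge (x 0) (x 1) = true

instance structure_set (A : Set ℕ) : (lang r).Structure A where
  funMap f := nomatch f
  RelMap R x := relMap r R fun i => x i

variable {r}

theorem IsEmb.of_embedding {A B : Set ℕ} (f : A ↪[lang r] B) : IsEmb r fun x => (f x : ℕ) where
  injective := Subtype.val_injective.comp f.injective
  sameType x q := Bool.eq_iff_iff.2
    (f.map_rel (n := 1) (Symb.unary q : (lang r).Relations 1) fun _ => x).symm
  edge_eq x y := Bool.eq_iff_iff.2
    (f.map_rel (n := 2) (Symb.edge : (lang r).Relations 2) ![x, y]).symm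

theorem IsEmb.exists_embedding {A B : Set ℕ} {f : A → ℕ} (hf : IsEmb r f) (hB : ∀ x, f x ∈ B) :
    ∃ g : A ↪[lang r] B, ∀ x, (g x : ℕ) = f x :=
  ⟨{ toFun := fun x => ⟨f x, hB x⟩
     inj' := fun x y h => hf.injective (congrArg Subtype.val h)
     map_fun' := fun f => nomatch f
     map_rel' := fun {n} R x => by
      cases R with
      | unary q => exact (Bool.eq_iff_iff.1 (hf.sameType (x 0) q)).symm
      | edge => exact (Bool.eq_iff_iff.1 (hf.edge_eq (x 0) (x 1))).symm }, fun _ => rfl⟩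

theorem isEmb_val (A : Set ℕ) : IsEmb r (Subtype.val : A → ℕ) :=
  ⟨Subtype.val_injective, fun _ _ => rfl, fun _ _ => rfl⟩

variable (r)

/-- The list of elements with number `i`; each list has infinitely many numbers. -/
def tup (i : ℕ) : List ℕ := Denumerable.ofNat (List ℕ) i.unpair.1

theorem tup_pair (l : List ℕ) (s : ℕ) : tup (Nat.pair (Encodable.encode l) s) = l := by
  simp [tup]

/-- The age of the structure on the natural numbers. -/
def ageRep : AgeRep (lang r) where
  carrier i := {x | x ∈ tup i}
  str i := structure_set r _
  tuple i := (tup i).attach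
  generates i := by
    refine top_unique fun x _ => FirstOrder.Language.Substructure.subset_closure ?_
    exact List.mem_attach _ _

variable {r}

theorem finite_carrier (i : ℕ) : ((ageRep r).carrier i).Finite := (tup i).finite_toSet

theorem mem_age {A : Set ℕ} (hA : A.Finite) :
    Bundled.of (c := (lang r).Structure) A ∈ (ageRep r).age := by
  obtain ⟨l, rfl⟩ : ∃ l : List ℕ, A = {x | x ∈ l} :=
    ⟨hA.toFinset.toList, by ext; simp⟩
  refine ⟨Nat.pair (Encodable.encode l) 0, ?_⟩
  have : (ageRep r).carrier (Nat.pair (Encodable.encode l) 0) = {x | x ∈ l} := by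
    simp only [ageRep, tup_pair]
  obtain ⟨f, hf⟩ := (isEmb_val (r := r) {x | x ∈ l}).exists_embedding
    (B := (ageRep r).carrier (Nat.pair (Encodable.encode l) 0)) fun x => this.superset x.2
  refine ⟨⟨Equiv.ofBijective f ⟨f.injective, fun y => ⟨⟨y, this.subset y.2⟩, Subtype.ext (hf _)⟩⟩,
    fun F => (nomatch F), fun R x => f.map_rel R x⟩⟩

theorem exists_copy_lt {A : Set ℕ} (hA : A.Finite) : ∃ N, ∀ x ∈ A, copy x < N := by
  obtain ⟨N, hN⟩ := (hA.image copy).bddAbove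
  exact ⟨N + 1, fun x hx => Nat.lt_succ_of_le (hN ⟨x, hx, rfl⟩)⟩

end Language

end Matching

/-! ### Amalgamation bases and coAP -/

namespace Matching

open CategoryTheory

variable {r : ℕ → ℕ → ℕ → Bool}

/-- Isolated elements may be replaced by fresh elements of the same type. -/
theorem isEmb_of_replace {A : Set ℕ} {N : ℕ} (hN : ∀ x ∈ A, copy x < N) {u : A → ℕ}
    (hu : ∀ x : A, u x = x ∨ (kind x = 0 ∧
      ∃ n, Live r (idx x) n ∧ u x = elt (idx x) (2 * n + 1) (copy x + N))) : IsEmb r u where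
  injective x y h := by
    have hx := hN x x.2
    have hy := hN y y.2
    apply Subtype.ext
    rcases hu x with h1 | ⟨h0, n, -, h1⟩ <;> rcases hu y with h2 | ⟨h0', m, -, h2⟩
    · rw [← h1, h, h2]
    · have := congrArg copy (h1.symm.trans (h.trans h2))
      simp at this
      omega
    · have := congrArg copy (h1.symm.trans (h.trans h2))
      simp at this
      omega
    · have h3 := congrArg copy (h1.symm.trans (h.trans h2))
      have h4 := congrArg idx (h1.symm.trans (h.trans h2))
      simp at h3 h4
      exact ext h4 (by omega) h3
  sameType x := by
    rcases hu x with h1 | ⟨h0, n, hn, h1⟩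
    · rw [h1]
      exact fun _ => rfl
    · rw [h1]
      exact hn.sameType h0 (by simp) (by simp)
  edge_eq x y := by
    have hx := hN x x.2
    have hy := hN y y.2
    rcases hu x with h1 | ⟨h0, n, -, h1⟩ <;> rcases hu y with h2 | ⟨h0', m, -, h2⟩
    · rw [h1, h2]
    -- No edges on either side: isolated points have none, two new points are both first ends, and a
    -- new point and an old one differ in copy number.
    all_goals
      rw [h1, h2, Bool.eq_iff_iff, edge_iff, edge_iff]
      simp only [idx_elt, kind_elt, copy_elt]
      omega

/-- A set of elements is closed if it contains no isolated element which has the type of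
non-isolated elements, and with every element the other end of the edge at this element. -/
structure IsSaturated (r : ℕ → ℕ → ℕ → Bool) (A : Set ℕ) : Prop where
  mate_mem : ∀ x ∈ A, mate x ∈ A
  not_live : ∀ x ∈ A, kind x = 0 → ∀ n, ¬ Live r (idx x) n

/-- An embedding keeps a non-live isolated point isolated, by its type, and carries any other point
along with its mate. So the range is closed under `mate`. -/
theorem IsSaturated.exists_eq_mate {A : Set ℕ} (hA : IsSaturated r A) {g : A → ℕ} (hg : IsEmb r g)
    (a : A) : ∃ b, g b = mate (g a) := by
  by_cases h0 : kind (a : ℕ) = 0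
  · refine ⟨a, (mate_of_kind_eq_zero ?_).symm⟩
    obtain h | ⟨n, -, hn⟩ := (hg.sameType a).kind_of_isolated h0
    · exact h
    · exact absurd hn (hA.not_live a a.2 h0 n)
  · refine ⟨⟨mate a, hA.mate_mem a a.2⟩, ?_⟩
    have := edge_or_edge_iff.2 ⟨h0, rfl⟩
    have h1 := hg.edge_eq a ⟨mate a, hA.mate_mem a a.2⟩
    have h2 := hg.edge_eq ⟨mate a, hA.mate_mem a a.2⟩ a
    simp only at h1 h2
    rw [h1, h2, edge_or_edge_iff] at this
    exact this.2

open Classical in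
/-- The extension of `f ∘ g⁻¹` by fresh copies of the elements outside of the range of `g`. -/
noncomputable def extend {A : Set ℕ} (f g : A → ℕ) (N x : ℕ) : ℕ :=
  if h : ∃ a, g a = x then f h.choose else elt (idx x) (kind x) (copy x + N)

theorem extend_apply {A : Set ℕ} {f g : A → ℕ} (hg : Function.Injective g) (N : ℕ) (a : A) :
    extend f g N (g a) = f a := by
  have h : ∃ b, g b = g a := ⟨a, rfl⟩
  rw [extend, dif_pos h, hg h.choose_spec]

theorem extend_of_notMem {A : Set ℕ} (f : A → ℕ) {g : A → ℕ} (N : ℕ) {x : ℕ}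
    (hx : ∀ a, g a ≠ x) : extend f g N x = elt (idx x) (kind x) (copy x + N) := by
  rw [extend, dif_neg fun ⟨a, ha⟩ => hx a ha]

/-- Free amalgamation: points outside the range of `g` move to copies beyond the range of `f`. Both
ranges are closed under `mate`, so no edge joins them to outside points. -/
theorem IsSaturated.isEmb_extend {A : Set ℕ} (hA : IsSaturated r A) {f g : A → ℕ} (hf : IsEmb r f)
    (hg : IsEmb r g) {N : ℕ} (hN : ∀ a, copy (f a) < N) (C : Set ℕ) :
    IsEmb r fun x : C => extend f g N x := by
  have hcopy : ∀ (a : A) (y : ℕ), f a ≠ elt (idx y) (kind y) (copy y + N) := by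
    intro a y h
    have := hN a
    rw [h, copy_elt] at this
    omega
  have hout : ∀ (a : A) (y : ℕ), (∀ b, g b ≠ y) →
      edge (g a) y = edge (f a) (elt (idx y) (kind y) (copy y + N)) ∧
      edge y (g a) = edge (elt (idx y) (kind y) (copy y + N)) (f a) := by
    intro a y hy
    have h1 : ¬ (edge (g a) y = true ∨ edge y (g a) = true) := by
      rw [edge_or_edge_iff]
      rintro ⟨-, h⟩
      obtain ⟨b, hb⟩ := hA.exists_eq_mate hg a
      exact hy b (hb.trans h.symm)
    have h2 : ¬ (edge (f a) (elt (idx y) (kind y) (copy y + N)) = true ∨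
        edge (elt (idx y) (kind y) (copy y + N)) (f a) = true) := by
      rw [edge_or_edge_iff]
      rintro ⟨-, h⟩
      obtain ⟨b, hb⟩ := hA.exists_eq_mate hf a
      exact hcopy b y (hb.trans h.symm)
    simp only [not_or, Bool.not_eq_true] at h1 h2
    rw [h1.1, h1.2, h2.1, h2.2]
    exact ⟨rfl, rfl⟩
  have hcases : ∀ x : ℕ, (∃ a, x = g a ∧ extend f g N x = f a) ∨
      ((∀ a, g a ≠ x) ∧ extend f g N x = elt (idx x) (kind x) (copy x + N)) := by
    intro x
    by_cases h : ∃ a, g a = x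
    · obtain ⟨a, rfl⟩ := h
      exact .inl ⟨a, rfl, extend_apply hg.injective N a⟩
    · push Not at h
      exact .inr ⟨h, extend_of_notMem f N h⟩
  refine ⟨fun x y hxy => Subtype.ext ?_, fun x => ?_, fun x y => ?_⟩
  · rcases hcases x with ⟨a, hx, h1⟩ | ⟨hx, h1⟩ <;> rcases hcases y with ⟨b, hy, h2⟩ | ⟨hy, h2⟩ <;>
      rw [h1, h2] at hxy
    · rw [hx, hy, hf.injective hxy]
    · exact absurd hxy (hcopy _ _)
    · exact absurd hxy.symm (hcopy _ _)
    · have e1 := congrArg idx hxy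
      have e2 := congrArg kind hxy
      have e3 := congrArg copy hxy
      simp only [idx_elt, kind_elt, copy_elt, Nat.add_right_cancel_iff] at e1 e2 e3
      exact ext e1 e2 e3
  · rcases hcases x with ⟨a, hx, h1⟩ | ⟨hx, h1⟩ <;> rw [h1]
    · rw [hx]
      exact fun q => (hg.sameType a q).symm.trans (hf.sameType a q)
    · exact sameType_of_eq (by simp) (by simp)
  · rcases hcases x with ⟨a, hx, h1⟩ | ⟨hx, h1⟩ <;> rcases hcases y with ⟨b, hy, h2⟩ | ⟨hy, h2⟩ <;>
      rw [h1, h2]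
    · rw [hx, hy, ← hg.edge_eq, ← hf.edge_eq]
    · rw [hx, (hout a y hy).1]
    · rw [hy, (hout b x hx).2]
    · rw [Bool.eq_iff_iff, edge_iff, edge_iff]
      simp

/-- `B` stays in place and `C` is moved by `extend`. The amalgam is the union inside `ℕ`, which
belongs to the age since it is finite. -/
theorem IsSaturated.isAmalgamationBase {A : Set ℕ} (hA : IsSaturated r A) (hfin : A.Finite) :
    IsAmalgamationBase (ageRep r).age (Bundled.of (c := (lang r).Structure) A) := by
  refine ⟨mem_age hfin, ?_⟩
  rintro B C ⟨i, ⟨eB⟩⟩ ⟨j, ⟨eC⟩⟩ fB fC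
  let f : A ↪[lang r] (ageRep r).carrier i := eB.toEmbedding.comp fB
  let g : A ↪[lang r] (ageRep r).carrier j := eC.toEmbedding.comp fC
  have hf : IsEmb r fun x => (f x : ℕ) := IsEmb.of_embedding f
  have hg : IsEmb r fun x => (g x : ℕ) := IsEmb.of_embedding g
  obtain ⟨N, hN⟩ := exists_copy_lt (finite_carrier (r := r) i)
  have hh := hA.isEmb_extend hf hg (fun a => hN _ (f a).2) ((ageRep r).carrier j)
  let h : ℕ → ℕ := extend (fun x => (f x : ℕ)) (fun x => (g x : ℕ)) N
  let D : Set ℕ := (ageRep r).carrier i ∪ h '' (ageRep r).carrier j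
  have hD : D.Finite := (finite_carrier i).union ((finite_carrier j).image _)
  obtain ⟨gB, hgB⟩ := (isEmb_val (r := r) ((ageRep r).carrier i)).exists_embedding (B := D)
    fun x => .inl x.2
  obtain ⟨gC, hgC⟩ := hh.exists_embedding (B := D) fun x => .inr ⟨x, x.2, rfl⟩
  refine ⟨_, mem_age hD, gB.comp eB.toEmbedding, gC.comp eC.toEmbedding, ?_⟩
  apply FirstOrder.Language.Embedding.ext
  intro x
  apply Subtype.ext
  exact (hgB (f x)).trans (((hgC (g x)).trans (extend_apply hg.injective N x)).symm)

/-- An amalgamation base contains no isolated element which has the type of non-isolated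
elements. -/
theorem not_live_of_isAmalgamationBase {A : Set ℕ} (hfin : A.Finite)
    (hA : IsAmalgamationBase (ageRep r).age (Bundled.of (c := (lang r).Structure) A))
    {x : ℕ} (hx : x ∈ A) (h0 : kind x = 0) {n m : ℕ} (hn : Live r (idx x) n)
    (hm : Live r (idx x) m) : n = m := by
  obtain ⟨N, hN⟩ := exists_copy_lt hfin
  -- A fresh edge of kind `n`; `A` embeds into `A ∪ {p n, q n}` by sending `x` to `p n` and fixing
  -- the rest.
  let p : ℕ → ℕ := fun n => elt (idx x) (2 * n + 1) (copy x + N)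
  let q : ℕ → ℕ := fun n => elt (idx x) (2 * n + 2) (copy x + N)
  let B : ℕ → Set ℕ := fun n => A ∪ {p n, q n}
  have hB : ∀ n, (B n).Finite := fun n => hfin.union (by simp)
  have hpq : ∀ n, edge (p n) (q n) = true := fun n => by
    simp [edge_iff, p, q]
  have key : ∀ n, Live r (idx x) n → ∃ f : A ↪[lang r] B n, (f ⟨x, hx⟩ : ℕ) = p n := by
    intro n hn
    have : IsEmb r fun y : A => if (y : ℕ) = x then p n else y := by
      refine isEmb_of_replace hN fun y => ?_
      by_cases hy : (y : ℕ) = x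
      · simp only [hy, if_true]
        exact .inr ⟨h0, n, hn, rfl⟩
      · simp [hy]
    obtain ⟨f, hf⟩ := this.exists_embedding (B := B n) fun y => by
      by_cases hy : (y : ℕ) = x
      · simp [hy, B]
      · simp [hy, B]
    exact ⟨f, by simp [hf]⟩
  obtain ⟨f, hf⟩ := key n hn
  obtain ⟨g, hg⟩ := key m hm
  obtain ⟨D, ⟨i, ⟨eD⟩⟩, gB, gC, hcomp⟩ := hA.2 _ _ (mem_age (hB n)) (mem_age (hB m)) f g
  let F : B n ↪[lang r] (ageRep r).carrier i := eD.toEmbedding.comp gB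
  let G : B m ↪[lang r] (ageRep r).carrier i := eD.toEmbedding.comp gC
  have hF : IsEmb r fun x => (F x : ℕ) := IsEmb.of_embedding F
  have hG : IsEmb r fun x => (G x : ℕ) := IsEmb.of_embedding G
  have hFG : (F (f ⟨x, hx⟩) : ℕ) = G (g ⟨x, hx⟩) :=
    congrArg (fun y => ((eD y : (ageRep r).carrier i) : ℕ)) (DFunLike.congr_fun hcomp ⟨x, hx⟩)
  let qn : B n := ⟨q n, by simp [B]⟩
  let qm : B m := ⟨q m, by simp [B]⟩
  -- In the amalgam the common image of `x` has edges to the images of `q n` and `q m`. These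
  -- coincide by uniqueness, and colours fix their kinds, forcing `n = m`.
  have h1 : edge (F (f ⟨x, hx⟩) : ℕ) (F qn) = true := by
    rw [← hF.edge_eq, hf]
    exact hpq n
  have h2 : edge (F (f ⟨x, hx⟩) : ℕ) (G qm) = true := by
    rw [hFG, ← hG.edge_eq, hg]
    exact hpq m
  have h3 := edge_right_unique h1 h2
  have h4 : kind (F qn : ℕ) = 2 * n + 2 :=
    ((hF.sameType qn).kind_eq (n := n) (by simp [qn, q])).trans (by simp [qn, q])
  have h5 : kind (G qm : ℕ) = 2 * m + 2 :=
    ((hG.sameType qm).kind_eq (n := m) (by simp [qm, q])).trans (by simp [qm, q])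
  rw [h3, h5] at h4
  omega

/-- Replace the isolated points that have a live kind by fresh first ends, then add all mates; the
result is saturated. -/
theorem hasCoAP : HasCoAP (ageRep r).age := by
  rintro X ⟨i, ⟨e⟩⟩
  obtain ⟨N, hN⟩ := exists_copy_lt (finite_carrier (r := r) i)
  classical
  let u : ℕ → ℕ := fun x => if h : kind x = 0 ∧ ∃ n, Live r (idx x) n then
    elt (idx x) (2 * h.2.choose + 1) (copy x + N) else x
  have hu : IsEmb r fun x : (ageRep r).carrier i => u x := by
    refine isEmb_of_replace hN fun x => ?_
    by_cases h : kind (x : ℕ) = 0 ∧ ∃ n, Live r (idx x) n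
    · exact .inr ⟨h.1, h.2.choose, h.2.choose_spec, dif_pos h⟩
    · exact .inl (dif_neg h)
  have hu' : ∀ x, kind (u x) = 0 → ∀ n, ¬ Live r (idx (u x)) n := by
    intro x
    by_cases h : kind (x : ℕ) = 0 ∧ ∃ n, Live r (idx x) n
    · simp only [u, dif_pos h, kind_elt]
      omega
    · simp only [u, dif_neg h]
      exact fun h0 n hn => h ⟨h0, n, hn⟩
  let U : Set ℕ := u '' (ageRep r).carrier i
  have hU : U.Finite := (finite_carrier i).image _
  have hcl : IsSaturated r (U ∪ mate '' U) := by
    refine ⟨?_, ?_⟩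
    · rintro x (hx | ⟨y, hy, rfl⟩)
      · exact .inr ⟨x, hx, rfl⟩
      · rw [mate_mate]
        exact .inl hy
    · have hU0 : ∀ x ∈ U, kind x = 0 → ∀ n, ¬ Live r (idx x) n := by
        rintro _ ⟨x, -, rfl⟩
        exact hu' x
      rintro x (hx | ⟨y, hy, rfl⟩) h0
      · exact hU0 x hx h0
      · have := mate_of_kind_eq_zero h0
        rw [mate_mate] at this
        rw [← this] at h0 ⊢
        exact hU0 y hy h0
  obtain ⟨f, -⟩ := hu.exists_embedding (B := U ∪ mate '' U) fun x => .inl ⟨x, x.2, rfl⟩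
  exact ⟨_, hcl.isAmalgamationBase (hU.union (hU.image _)), ⟨f.comp e.toEmbedding⟩⟩

end Matching

/-! ### Computability of the structure and its age -/

namespace Matching

open CategoryTheory

theorem computable_idx : Computable idx := Computable.fst.comp Computable.unpair

theorem computable_kind : Computable kind :=
  (Computable.fst.comp Computable.unpair).comp (Computable.snd.comp Computable.unpair)

theorem computable_copy : Computable copy :=
  (Computable.snd.comp Computable.unpair).comp (Computable.snd.comp Computable.unpair)

theorem computable_decide_eq {α : Type} [Primcodable α] {f g : α → ℕ} (hf : Computable f)
    (hg : Computable g) : Computable fun a => decide (f a = g a) :=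
  (Primrec.eq (α := ℕ)).decide.to_comp.comp hf hg

theorem computable_and {α : Type} [Primcodable α] {f g : α → Bool} (hf : Computable f)
    (hg : Computable g) : Computable fun a => f a && g a :=
  Primrec.and.to_comp.comp hf hg

theorem computable_or {α : Type} [Primcodable α] {f g : α → Bool} (hf : Computable f)
    (hg : Computable g) : Computable fun a => f a || g a :=
  Primrec.or.to_comp.comp hf hg

theorem computable_not {α : Type} [Primcodable α] {f : α → Bool} (hf : Computable f) :
    Computable fun a => !f a :=
  Primrec.not.to_comp.comp hf

theorem computable_edge : Computable₂ edge := by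
  have h1 : Computable fun p : ℕ × ℕ => p.1 := Computable.fst
  have h2 : Computable fun p : ℕ × ℕ => p.2 := Computable.snd
  exact computable_and (computable_and (computable_and
    (computable_decide_eq (computable_idx.comp h1) (computable_idx.comp h2))
    (computable_decide_eq (computable_copy.comp h1) (computable_copy.comp h2)))
    (computable_decide_eq (computable_kind.comp h2)
      (Computable.succ.comp (computable_kind.comp h1))))
    (Computable.nat_bodd.comp (computable_kind.comp h1))

variable {r : ℕ → ℕ → ℕ → Bool}

theorem computable_comp₃ (hr : Computable fun x : ℕ × ℕ × ℕ => r x.1 x.2.1 x.2.2) {α : Type}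
    [Primcodable α] {f g h : α → ℕ} (hf : Computable f) (hg : Computable g) (hh : Computable h) :
    Computable fun a => r (f a) (g a) (h a) :=
  hr.comp (hf.pair (hg.pair hh))

theorem computable_pred (hr : Computable fun x : ℕ × ℕ × ℕ => r x.1 x.2.1 x.2.2) :
    Computable₂ (pred r) := by
  have q1 : Computable fun p : ℕ × ℕ => p.1.unpair.1 :=
    (Computable.fst.comp Computable.unpair).comp Computable.fst
  have q2 : Computable fun p : ℕ × ℕ => p.1.unpair.2 :=
    (Computable.snd.comp Computable.unpair).comp Computable.fst
  have hi : Computable fun p : ℕ × ℕ => idx p.2 := computable_idx.comp Computable.snd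
  have hk : Computable fun p : ℕ × ℕ => kind p.2 := computable_kind.comp Computable.snd
  have ha : Computable fun p : ℕ × ℕ => decide (kind p.2 = 0) || (kind p.2).bodd :=
    computable_or (computable_decide_eq hk (Computable.const 0)) (Computable.nat_bodd.comp hk)
  have hrr : Computable fun p : ℕ × ℕ => r (idx p.2) (kind p.2).div2.div2 p.1.unpair.2.unpair.2 :=
    computable_comp₃ hr hi (Computable.nat_div2.comp (Computable.nat_div2.comp hk))
      ((Computable.snd.comp Computable.unpair).comp q2)
  refine computable_or (computable_or (computable_and (computable_and ?_ ?_) ha)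
    (computable_and (computable_and ?_ ?_) (computable_not ha)))
    (computable_and (computable_and (computable_and ?_ ?_) (Computable.nat_bodd.comp hk))
      (computable_not hrr))
  · exact computable_decide_eq q1 (Computable.const 0)
  · exact computable_decide_eq q2 hi
  · exact computable_decide_eq q1 (Computable.const 1)
  · exact computable_decide_eq q2 (Primrec₂.natPair.to_comp.comp hi hk)
  · exact computable_decide_eq q1 (Computable.const 2)
  · exact computable_decide_eq ((Computable.fst.comp Computable.unpair).comp q2) hk

/-- The numbering of the relation symbols. -/
def symb : ℕ → Σ n, Symb n
  | 0 => ⟨2, .edge⟩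
  | q + 1 => ⟨1, .unary q⟩

variable (r)

/-- The computable representation of the language in which `edge` has the number `0` and the
`q`-th unary relation symbol has the number `q + 1`. -/
def compRep : CompRep (lang r) where
  relDom := Set.univ
  funDom := ∅
  rel :=
    { toFun := fun n => symb n
      invFun := fun R => match R with
        | ⟨_, .edge⟩ => ⟨0, trivial⟩
        | ⟨_, .unary q⟩ => ⟨q + 1, trivial⟩
      left_inv := by rintro ⟨_ | q, _⟩ <;> rfl
      right_inv := by rintro ⟨_, _ | _⟩ <;> rfl }
  func :=
    { toFun := fun n => absurd n.2 (Set.notMem_empty _)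
      invFun := fun F => nomatch F
      left_inv := fun n => absurd n.2 (Set.notMem_empty _)
      right_inv := fun F => nomatch F }
  relDom_computable := ⟨fun _ => .isTrue trivial, Computable.const true⟩
  funDom_computable := ⟨fun _ => .isFalse id, Computable.const false⟩
  disjoint := Set.disjoint_empty _
  arity_computable := by
    refine ⟨fun n => Nat.casesOn n 2 fun _ => 1, ?_, ?_, fun n => absurd n.2 (Set.notMem_empty _)⟩
    · exact Computable.nat_casesOn Computable.id (Computable.const 2) (Computable.const 1).to₂
    · rintro ⟨_ | q, _⟩ <;> rfl

/-- A decision procedure for the statement that `a` is a tuple of elements of `X` for which the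
relation with number `n` has the truth value `b`. -/
def check (X : ℕ → Bool) (b : Bool) (n : ℕ) (a : List ℕ) : Bool :=
  Nat.casesOn n
    -- The length test makes the default value of `getD` harmless.
    (decide (a.length = 2) && (X (a.getD 0 0) && (X (a.getD 1 0) &&
      decide ((edge (a.getD 0 0) (a.getD 1 0)).toNat = b.toNat))))
    fun q => decide (a.length = 1) && (X (a.getD 0 0) &&
      decide ((pred r q (a.getD 0 0)).toNat = b.toNat))

variable {r}

theorem computable_check (hr : Computable fun x : ℕ × ℕ × ℕ => r x.1 x.2.1 x.2.2) {ι : Type}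
    [Primcodable ι] {X : ι → ℕ → Bool} (hX : Computable₂ X) (b : Bool) :
    Computable fun p : ι × ℕ × List ℕ => check r (X p.1) b p.2.1 p.2.2 := by
  have hn : Computable fun p : ι × ℕ × List ℕ => p.2.1 := Computable.fst.comp Computable.snd
  have ha : Computable fun p : ι × ℕ × List ℕ => p.2.2 := Computable.snd.comp Computable.snd
  have hl := Computable.list_length.comp ha
  have h0 : Computable fun p : ι × ℕ × List ℕ => p.2.2.getD 0 0 :=
    (Primrec.list_getD 0).to_comp.comp ha (Computable.const 0)
  have h1 : Computable fun p : ι × ℕ × List ℕ => p.2.2.getD 1 0 :=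
    (Primrec.list_getD 0).to_comp.comp ha (Computable.const 1)
  have hb : Computable Bool.toNat := (Primrec.dom_bool _).to_comp
  refine Computable.nat_casesOn hn ?_ ?_
  · exact computable_and (computable_decide_eq hl (Computable.const 2))
      (computable_and (hX.comp Computable.fst h0) (computable_and (hX.comp Computable.fst h1)
        (computable_decide_eq (hb.comp (computable_edge.comp h0 h1)) (Computable.const _))))
  · exact computable_and (computable_decide_eq (hl.comp Computable.fst) (Computable.const 1))
      (computable_and ((hX.comp Computable.fst h0).comp Computable.fst)
        (computable_decide_eq (hb.comp ((computable_pred hr).comp Computable.snd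
          (h0.comp Computable.fst))) (Computable.const _)))

theorem toNat_eq_toNat_iff {b c : Bool} : b.toNat = c.toNat ↔ b = c := by
  cases b <;> cases c <;> simp

theorem check_zero_iff {X : ℕ → Bool} {b : Bool} {a : List ℕ} : check r X b 0 a = true ↔
    ∃ x y, a = [x, y] ∧ X x = true ∧ X y = true ∧ edge x y = b := by
  change (_ && (_ && (_ && _))) = true ↔ _
  simp only [Bool.and_eq_true, decide_eq_true_eq, toNat_eq_toNat_iff, List.length_eq_two]
  constructor
  · rintro ⟨⟨x, y, rfl⟩, h⟩
    exact ⟨x, y, rfl, by simpa using h⟩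
  · rintro ⟨x, y, rfl, h⟩
    exact ⟨⟨x, y, rfl⟩, by simpa using h⟩

theorem check_succ_iff {X : ℕ → Bool} {b : Bool} {q : ℕ} {a : List ℕ} :
    check r X b (q + 1) a = true ↔ ∃ x, a = [x] ∧ X x = true ∧ pred r q x = b := by
  simp only [check, Bool.and_eq_true, decide_eq_true_eq, toNat_eq_toNat_iff, List.length_eq_one_iff]
  constructor
  · rintro ⟨⟨x, rfl⟩, h⟩
    exact ⟨x, rfl, by simpa using h⟩
  · rintro ⟨x, rfl, h⟩
    exact ⟨⟨x, rfl⟩, by simpa using h⟩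

theorem holds_iff_check {A : Set ℕ} {X : ℕ → Bool} (hX : ∀ x, X x = true ↔ x ∈ A) {n : ℕ}
    {a : List ℕ} : (compRep r).Holds A n a ↔ check r X true n a = true := by
  cases n with
  | zero =>
    rw [check_zero_iff]
    constructor
    · rintro ⟨hn, x, rfl, h⟩
      exact ⟨x (0 : Fin 2), x (1 : Fin 2), rfl, (hX _).2 (x (0 : Fin 2)).2,
        (hX _).2 (x (1 : Fin 2)).2, h⟩
    · rintro ⟨x, y, rfl, hx, hy, h⟩
      exact ⟨trivial, ![⟨x, (hX x).1 hx⟩, ⟨y, (hX y).1 hy⟩], rfl, h⟩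
  | succ q =>
    rw [check_succ_iff]
    constructor
    · rintro ⟨hn, x, rfl, h⟩
      exact ⟨x (0 : Fin 1), rfl, (hX _).2 (x (0 : Fin 1)).2, h⟩
    · rintro ⟨x, rfl, hx, h⟩
      exact ⟨trivial, ![⟨x, (hX x).1 hx⟩], rfl, h⟩

theorem fails_iff_check {A : Set ℕ} {X : ℕ → Bool} (hX : ∀ x, X x = true ↔ x ∈ A) {n : ℕ}
    {a : List ℕ} : (compRep r).Fails A n a ↔ check r X false n a = true := by
  cases n with
  | zero =>
    rw [check_zero_iff]
    constructor
    · rintro ⟨hn, x, rfl, h⟩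
      exact ⟨x (0 : Fin 2), x (1 : Fin 2), rfl, (hX _).2 (x (0 : Fin 2)).2,
        (hX _).2 (x (1 : Fin 2)).2, Bool.eq_false_iff.2 h⟩
    · rintro ⟨x, y, rfl, hx, hy, h⟩
      exact ⟨trivial, ![⟨x, (hX x).1 hx⟩, ⟨y, (hX y).1 hy⟩], rfl, Bool.eq_false_iff.1 h⟩
  | succ q =>
    rw [check_succ_iff]
    constructor
    · rintro ⟨hn, x, rfl, h⟩
      exact ⟨x (0 : Fin 1), rfl, (hX _).2 (x (0 : Fin 1)).2, Bool.eq_false_iff.2 h⟩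
    · rintro ⟨x, rfl, hx, h⟩
      exact ⟨trivial, ![⟨x, (hX x).1 hx⟩], rfl, Bool.eq_false_iff.1 h⟩

theorem computablePred_of_iff {α : Type} [Primcodable α] {p : α → Prop} {f : α → Bool}
    (hf : Computable f) (h : ∀ a, p a ↔ f a = true) : ComputablePred p :=
  ⟨fun a => decidable_of_iff _ (h a).symm, hf.of_eq fun a => by simp [h a]⟩

theorem uniformlyComputable (hr : Computable fun x : ℕ × ℕ × ℕ => r x.1 x.2.1 x.2.2) {ι : Type}
    [Primcodable ι] {X : ι → ℕ → Bool} (hX : Computable₂ X) {A : ι → Set ℕ}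
    (hA : ∀ i x, X i x = true ↔ x ∈ A i) : (compRep r).UniformlyComputable A := by
  refine ⟨computablePred_of_iff hX fun p => (hA p.1 p.2).symm, ?_, ?_, ?_⟩
  · exact (computablePred_of_iff (computable_check hr hX true)
      fun p => holds_iff_check (hA p.1)).to_re
  · exact (computablePred_of_iff (computable_check hr hX false)
      fun p => fails_iff_check (hA p.1)).to_re
  · refine (computablePred_of_iff (Computable.const false) fun p => ?_).to_re
    simp only [Bool.false_eq_true, iff_false]
    rintro ⟨hn, -⟩
    exact hn

theorem computable_tup : Computable tup :=
  (Computable.ofNat (List ℕ)).comp (Computable.fst.comp Computable.unpair)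

theorem map_tuple_ageRep (i : ℕ) : ((ageRep r).tuple i).map Subtype.val = tup i :=
  List.attach_map_subtype_val _

/-- The left-hand side is the form that the list of underlying numbers takes in the definitions of
computable and canonical ages. -/
theorem coe_list_eq_map {A : Set ℕ} (l : List A) :
    List.map (fun x => x) (do let a ← l; pure (a : ℕ)) = l.map Subtype.val := by
  simp

theorem isComputable_ageRep (hr : Computable fun x : ℕ × ℕ × ℕ => r x.1 x.2.1 x.2.2) :
    (ageRep r).IsComputable (compRep r) := by
  refine ⟨computable_tup.of_eq fun i => ((coe_list_eq_map _).trans (map_tuple_ageRep i)).symm, ?_⟩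
  have hmem : PrimrecRel fun (l : List ℕ) (x : ℕ) => ∃ y ∈ l, y = x :=
    PrimrecRel.exists_mem_list Primrec.eq
  refine uniformlyComputable hr (X := fun i x => decide (∃ y ∈ tup i, y = x)) ?_ fun i x => ?_
  · exact hmem.decide.to_comp.comp (computable_tup.comp Computable.fst) Computable.snd
  · simp [ageRep]

theorem isCanonicalAgeOf_ageRep : (ageRep r).IsCanonicalAgeOf Set.univ := by
  refine ⟨fun i => (tup i).map fun x => ⟨x, trivial⟩, ?_, fun t => ?_, fun i => ?_⟩
  · exact computable_tup.of_eq fun i => by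
      rw [coe_list_eq_map, List.map_map]
      exact (List.map_id _).symm
  -- The second component of a number does not affect its tuple, so every tuple recurs.
  · refine Set.infinite_of_injective_forall_mem
      (f := fun s => Nat.pair (Encodable.encode (t.map Subtype.val)) s) (fun s s' h => ?_) fun s => ?_
    · exact (Nat.pair_eq_pair.1 h).2
    · change (tup _).map _ = t
      rw [tup_pair, List.map_map]
      exact List.map_id _
  · obtain ⟨f, hf⟩ := (isEmb_val (r := r) ((ageRep r).carrier i)).exists_embedding
      (B := Set.univ) fun _ => trivial
    refine ⟨f, hf, ?_⟩
    change _ = (tup i).map _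
    rw [← map_tuple_ageRep (r := r), List.map_map]
    exact List.map_congr_left fun x _ => Subtype.ext (hf x)

/-! ### Coding `0''` into the distinguished extensions -/

open Oracle in
theorem reducible_of_hasCcoAP {Z : Set ℕ} (hZ : ∀ e, e ∈ Z ↔ ∃ n, ∀ t, r e n t = true) {S : Set ℕ}
    (h : (ageRep r).HasCcoAP S) : Reducible Z S := by
  obtain ⟨W, φ, hW, hWS, -⟩ := h
  -- A number of the one-point structure consisting of an isolated point of index `e`.
  let code : ℕ → ℕ := fun e => Nat.pair (Encodable.encode [elt e 0 0]) 0
  have htup : ∀ e, tup (code e) = [elt e 0 0] := fun e => tup_pair _ _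
  have hlive : ∀ e n, (∀ t, r e n t = true) → Live r e (2 * n) ∧ Live r e (2 * n + 1) := by
    intro e n hn
    constructor
    · intro s
      rw [show 2 * n / 2 = n by omega]
      exact hn s
    · intro s
      rw [show (2 * n + 1) / 2 = n by omega]
      exact hn s
  -- Search `W` for any member with this domain and test whether the image of the point is isolated.
  -- The range has length one, so the default of `getD` plays no role.
  refine RecursiveIn.iff_nat.2 (recursiveIn_of_enumerable hWS (q := fun e F => decide (F.1 = code e))
    (out := fun F => cond (decide (kind (F.2.2.getD 0 0) = 0)) 0 1) ?_ ?_ ?_ ?_)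
  · refine computable_decide_eq (Computable.fst.comp Computable.snd)
      (Primrec₂.natPair.to_comp.comp (Computable.encode.comp ?_) (Computable.const 0))
    exact Computable.list_cons.comp (Primrec₂.natPair.to_comp.comp Computable.fst
      (Computable.const _)) (Computable.const [])
  · exact Computable.cond (computable_decide_eq (computable_kind.comp
      ((Primrec.list_getD 0).to_comp.comp (Computable.snd.comp Computable.snd) (Computable.const 0)))
      (Computable.const 0)) (Computable.const 0) (Computable.const 1)
  · intro e
    obtain ⟨F, hF, hdom⟩ := hW.distinguished.exists_dom (code e)
    exact ⟨F, hF, decide_eq_true hdom⟩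
  · rintro e ⟨i, j, c⟩ hF hdom
    obtain rfl : i = code e := of_decide_eq_true hdom
    obtain ⟨f, hf⟩ := hW.distinguished.isEmbedding _ hF
    have hbase := hW.base _ hF
    change (ageRep r).carrier (code e) ↪[lang r] (ageRep r).carrier j at f
    change ((ageRep r).tuple (code e)).map (fun x => (f x : ℕ)) = c at hf
    have hx : elt e 0 0 ∈ (ageRep r).carrier (code e) := by
      simp [ageRep, htup]
    have ht := map_tuple_ageRep (r := r) (code e)
    rw [htup, List.map_eq_singleton_iff] at ht
    obtain ⟨x, hx, hx'⟩ := ht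
    rw [hx] at hf
    subst hf
    have hst := (IsEmb.of_embedding f).sameType x
    have hk : kind (x : ℕ) = 0 := by rw [hx', kind_elt]
    have hi : idx (x : ℕ) = e := by rw [hx', idx_elt]
    by_cases he : e ∈ Z
    -- A witness makes two distinct kinds live, which an isolated point of an amalgamation base does
    -- not allow.
    · have : kind (f x : ℕ) ≠ 0 := by
        intro h0
        obtain ⟨n, hn⟩ := (hZ e).1 he
        have hidx := hst.idx_eq hk
        have := not_live_of_isAmalgamationBase (finite_carrier j) hbase (f x).2 h0
          (n := 2 * n) (m := 2 * n + 1)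
          (by rw [hidx, hi]; exact (hlive e n hn).1) (by rw [hidx, hi]; exact (hlive e n hn).2)
        omega
      simp [he, this]
    -- Nothing is live at index `e`, so the type of the point forces its image to be isolated.
    · have : kind (f x : ℕ) = 0 := by
        obtain h | ⟨n, -, hn⟩ := hst.kind_of_isolated hk
        · exact h
        · exact absurd ((hZ e).2 ⟨n / 2, hi ▸ hn⟩) he
      simp [he, this]

end Matching

theorem mainTheorem6 :
    ∃ (L : FirstOrder.Language.{0, 0}) (ρ : CompRep L) (M : Set ℕ) (_ : L.Structure M)
      (K : AgeRep L),
      IsEmpty (L.Relations 0) ∧ Infinite (Σ n, L.Relations n) ∧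
      ρ.IsComputable M ∧ K.IsComputable ρ ∧ K.IsCanonicalAgeOf M ∧
      HasCoAP K.age ∧
      ∀ S : Set ℕ, K.HasCcoAP S → Oracle.Reducible Oracle.zeroDoubleJump S := by
  obtain ⟨r, hr, hZ⟩ := Oracle.exists_computable_forall_zeroDoubleJump
  refine ⟨Matching.lang r, Matching.compRep r, Set.univ, Matching.structure_set r _,
    Matching.ageRep r, ⟨fun R => nomatch R⟩, ?_, ?_, Matching.isComputable_ageRep hr,
    Matching.isCanonicalAgeOf_ageRep, Matching.hasCoAP, fun S => Matching.reducible_of_hasCcoAP hZ⟩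
  · exact Infinite.of_injective (fun q : ℕ => ⟨1, Matching.Symb.unary q⟩) fun p q h => by
      cases h
      rfl
  · exact Matching.uniformlyComputable hr (X := fun _ _ => true) (Computable.const true)
      fun _ x => by simp
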